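/- **Theorem.** Let $\nu,L,T,C_0>0$, $\delta\in(1/2,1)$, $\Omega=[0,L]^3$, $R_0=L/4$, and let $\|\cdot\|$, $(\cdot,\cdot)$ be the norm and inner product of $L^2(\Omega)^3$. Let $H$ be the space of $L$-periodic, divergence-free, mean-zero vector fields in $L^2(\Omega)^3$, let $A=-\Delta$ be the Stokes operator on $H$ (its powers being defined by Fourier series), and $V=D(A^{1/2})$. Call $C>0$ an Agmon constant for the period $L$ if $$\|w\|_{L^\infty}\le C\,\|A^{1/2}w\|^{1/2}\|Aw\|^{1/2}\qquad\text{for all } w\in D(A).$$ There is a constant that is an Agmon constant for every period $L>0$. Moreover, with $L$ fixed, let $C_A$ be any Agmon constant for the period $L$; then the following holds. Let $\eta\in C^1(\mathbb R)$ satisfy $0\le\eta\le1$, $\operatorname{supp}\eta\subseteq[0,T]$, $|\eta'|\le\frac{C_0}{T}\eta^{\delta}$ and $c_\eta:=\frac1T\int_0^T\eta\,dt>0$. Let $f\in D(A^{1/2})$, $f\ne0$, be a time-independent force and let $u$ be a Leray–Hopf weak solution on $[0,\infty)$ of the periodic Navier–Stokes equations with viscosity $\nu$ and force $f$; that is, $u\in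 L^\infty([0,\infty),H)\cap L^2_{loc}((0,\infty),V)$, $$\frac{d}{dt}(u,v)+\nu(A^{1/2}u,A^{1/2}v)-\int_\Omega\big((u\cdot\nabla)v\big)\cdot u\,dx=(f,v)$$ in the sense of distributions on $(0,\infty)$ for all smooth $v\in H$ (equivalently, all $v\in V$), and $\nu\int_{t_0}^{t_1}\|A^{1/2}u\|^2\,dt\le\frac12\|u(t_0)\|^2-\frac12\|u(t_1)\|^2+\int_{t_0}^{t_1}(f,u)\,dt$ for a.e. $t_0>0$ and all $t_1\ge t_0$. Put $$e_0=\frac1T\frac1{R_0^3}\int_0^T\eta^{\delta}\,\frac{\|u\|^2}{2}\,dt,\qquad \gamma_f=\frac{C_0}{\nu T}\frac{\|A^{-1}f\|}{\|f\|}+1 .$$ If $$\|f\|\ \ge\ \frac{2\gamma_f^2\nu^2}{c_\eta C_A}\,\frac{\|f\|^{1/2}}{\|A^{1/2}f\|^{1/2}}\,\frac{\|f\|^2}{\|A^{-1/2}f\|^2},$$ then $$e_0\ \ge\ \frac{c_\eta}{4C_A}\,\frac1{R_0^{5/2}}\,\frac{\|A^{-1/2}f\|^2}{\|f\|^{3/2}\|A^{1/2}f\|^{1/2}}\,\frac{\|f\|}{R_0^{1/2}}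 .$$ -/

import Mathlib

open MeasureTheory Set
open scoped ContDiff

noncomputable section

namespace PeriodicNSE

/-- Three-dimensional Euclidean space. -/
abbrev E3 : Type := EuclideanSpace ℝ (Fin 3)

/-- The basic periodic box `[0, L]³`. -/
def box (L : ℝ) : Set E3 := {x | ∀ i, x i ∈ Icc (0 : ℝ) L}

/-- `L`-periodicity in each coordinate direction. -/
def IsPeriodic {α : Type} (L : ℝ) (w : E3 → α) : Prop :=
  ∀ (x : E3) (i : Fin 3), w (x + EuclideanSpace.single i L) = w x

/-- The `L²` inner product over the box. -/
def innerL2 (L : ℝ) (w v : E3 → E3) : ℝ := ∫ x in box L, inner ℝ (w x) (v x)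

/-- The `L²` norm over the box. -/
def normL2 (L : ℝ) (w : E3 → E3) : ℝ := Real.sqrt (∫ x in box L, ‖w x‖ ^ 2)

/-- The space `H`: periodic, square integrable, weakly divergence-free fields of zero mean.
Here `fderiv ℝ φ x (w x)` is `w(x) · ∇φ(x)`. -/
structure MemH (L : ℝ) (w : E3 → E3) : Prop where
  periodic : IsPeriodic L w
  memLp : MemLp w 2 (volume.restrict (box L))
  divFree : ∀ φ : E3 → ℝ, ContDiff ℝ ∞ φ → IsPeriodic L φ →
    ∫ x in box L, fderiv ℝ φ x (w x) = 0
  meanZero : ∫ x in box L, w x = 0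

/-- The Fourier coefficient `L⁻³ ∫ w_j(x) exp(-2πi k·x/L) dx` of the `j`-th component. -/
def fourierCoef (L : ℝ) (w : E3 → E3) (k : Fin 3 → ℤ) (j : Fin 3) : ℂ :=
  ((L : ℂ) ^ 3)⁻¹ * ∫ x in box L,
    ((w x j : ℝ) : ℂ) *
      Complex.exp (-(2 * (Real.pi : ℂ) * Complex.I / (L : ℂ)) * ∑ i, (k i : ℂ) * ((x i : ℝ) : ℂ))

/-- The eigenvalue `(2π/L)² |k|²` of the Stokes operator `A = -Δ` on the mode `exp(2πi k·x/L)`. -/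
def eigenval (L : ℝ) (k : Fin 3 → ℤ) : ℝ := (2 * Real.pi / L) ^ 2 * ∑ i, (k i : ℝ) ^ 2

/-- The domain `D(A^s)` in `H` of the (spectrally defined) power `A^s`. -/
def MemDomA (L s : ℝ) (w : E3 → E3) : Prop :=
  MemH L w ∧
    Summable fun k : Fin 3 → ℤ => eigenval L k ^ (2 * s) * ∑ j, ‖fourierCoef L w k j‖ ^ 2

/-- The inner product `(A^s w, A^s v)`. -/
def innerA (L s : ℝ) (w v : E3 → E3) : ℝ :=
  L ^ 3 * ∑' k : Fin 3 → ℤ, eigenval L k ^ (2 * s) *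
    ∑ j, (fourierCoef L w k j * (starRingEnd ℂ) (fourierCoef L v k j)).re

/-- The norm `‖A^s w‖`. -/
def normA (L s : ℝ) (w : E3 → E3) : ℝ :=
  Real.sqrt (L ^ 3 * ∑' k : Fin 3 → ℤ, eigenval L k ^ (2 * s) * ∑ j, ‖fourierCoef L w k j‖ ^ 2)

/-- `C` is a constant for the Agmon inequality
`‖w‖_∞ ≤ C ‖A^{1/2} w‖^{1/2} ‖A w‖^{1/2}` on `D(A)`. -/
def IsAgmonConstant (L C : ℝ) : Prop :=
  0 < C ∧ ∀ w : E3 → E3, MemDomA L 1 w →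
    ∀ᵐ x ∂(volume.restrict (box L)),
      ‖w x‖ ≤ C * normA L (1 / 2) w ^ (1 / 2 : ℝ) * normA L 1 w ^ (1 / 2 : ℝ)

/-- Leray–Hopf weak solutions on `[0, ∞)` of the periodic Navier–Stokes equations with viscosity
`ν` and time-independent force `f`. -/
structure IsLerayHopf (ν L : ℝ) (f : E3 → E3) (u : ℝ → E3 → E3) : Prop where
  /-- `u` is a measurable bounded function of time with values in `H`. -/
  measurable : AEStronglyMeasurable (Function.uncurry u)
    ((volume.restrict (Ici (0 : ℝ))).prod (volume.restrict (box L)))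
  memH : ∀ t, 0 ≤ t → MemH L (u t)
  bounded : ∃ M : ℝ, ∀ᵐ t ∂(volume.restrict (Ici (0 : ℝ))), normL2 L (u t) ≤ M
  /-- `u` is locally square integrable on `(0, ∞)` with values in `V = D(A^{1/2})`. -/
  memV : ∀ᵐ t ∂(volume.restrict (Ioi (0 : ℝ))), MemDomA L (1 / 2) (u t)
  locSqIntegrable : ∀ a b : ℝ, 0 < a → a < b →
    IntegrableOn (fun t => normA L (1 / 2) (u t) ^ 2) (Icc a b)
  /-- `(u,v)_t + ν (A^{1/2}u, A^{1/2}v) - (B(u,v),u) = (f,v)` as distributions on `(0, ∞)`, for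
  all smooth `v` in `H`, where `(B(u,v),u) = ∫ ((u·∇)v)·u`. -/
  weakForm : ∀ v : E3 → E3, ContDiff ℝ ∞ v → MemH L v →
    ∀ φ : ℝ → ℝ, ContDiff ℝ ∞ φ → HasCompactSupport φ → tsupport φ ⊆ Ioi 0 →
      -(∫ t in Ioi (0 : ℝ), deriv φ t * innerL2 L (u t) v)
        + ν * (∫ t in Ioi (0 : ℝ), φ t * innerA L (1 / 2) (u t) v)
        - (∫ t in Ioi (0 : ℝ), φ t * ∫ x in box L, inner ℝ (fderiv ℝ v x (u t x)) (u t x))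
        = ∫ t in Ioi (0 : ℝ), φ t * innerL2 L f v
  energyIneq : ∀ᵐ t₀ ∂(volume.restrict (Ioi (0 : ℝ))), ∀ t₁, t₀ ≤ t₁ →
    ν * (∫ t in t₀..t₁, normA L (1 / 2) (u t) ^ 2)
      ≤ normL2 L (u t₀) ^ 2 / 2 - normL2 L (u t₁) ^ 2 / 2 + ∫ t in t₀..t₁, innerL2 L f (u t)

/-- Refined time cut-offs on `[0, T]`. -/
structure IsTimeCutoff (T C₀ δ : ℝ) (η : ℝ → ℝ) : Prop where
  contDiff : ContDiff ℝ 1 η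
  nonneg : ∀ t, 0 ≤ η t
  le_one : ∀ t, η t ≤ 1
  support_subset : Function.support η ⊆ Icc 0 T
  deriv_bound : ∀ t, |deriv η t| ≤ C₀ / T * η t ^ δ

/-- The mean `c_η = T⁻¹ ∫₀ᵀ η`. -/
def cutoffMean (T : ℝ) (η : ℝ → ℝ) : ℝ := 1 / T * ∫ t in (0 : ℝ)..T, η t

/-- The time-localized kinetic energy `e₀ = T⁻¹ R₀⁻³ ∫₀ᵀ η^δ ‖u‖²/2`, with `R₀ = L/4`. -/
def energy (L T δ : ℝ) (η : ℝ → ℝ) (u : ℝ → E3 → E3) : ℝ :=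
  1 / T * (1 / (L / 4) ^ 3) * ∫ t in (0 : ℝ)..T, η t ^ δ * (normL2 L (u t) ^ 2 / 2)

/-- The factor `γ_f = C₀/(νT) · ‖A⁻¹f‖/‖f‖ + 1`. -/
def gammaF (ν L T C₀ : ℝ) (f : E3 → E3) : ℝ :=
  C₀ / (ν * T) * (normA L (-1) f / normL2 L f) + 1

end PeriodicNSE

end

open MeasureTheory Set
open scoped ContDiff

noncomputable section

/-! The weak formulation is tested with `A⁻¹f` times the cut-off `η`. Since `(A^{1/2}u, A^{1/2}A⁻¹f)
= (u, f)`, the viscous term loses its derivatives, and `‖A^{-1/2}f‖² ∫η = -∫η'(u, A⁻¹f) + ν∫η(u, f)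
- ∫η∫((u·∇)A⁻¹f)·u`. On the right, `|η'| ≤ (C₀/T)η^δ` and `η ≤ η^δ`. Agmon's inequality, applied to
the directional derivatives of `A⁻¹f`, bounds the gradient of `A⁻¹f` by `K = C_A
‖f‖^{1/2}‖A^{1/2}f‖^{1/2}`. Put `D = c_η‖A^{-1/2}f‖²`, `G = (C₀/T)‖A⁻¹f‖ + ν‖f‖ = ν‖f‖γ_f` and `E =
T⁻¹∫η^δ‖u‖²`. Young's inequality gives `D ≤ G(θ/2 + E/(2θ)) + K E` for every `θ > 0`. The lower
bound on the force says exactly that `G²X ≤ D²/4` for `X = D/(2K)`. If `E < X`, then `θ = √X` bounds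
the first term by `D/2` and the second strictly by `D/2`, a contradiction. Hence `E ≥ X`, which is
the claim because `e₀ = E/(2R₀³)`.

Test fields must be smooth, so `A⁻¹f` is truncated to finite symmetric sets of frequencies with
bounds uniform in the set; the limit is taken only in `‖A^{-1/2}f‖²`. The time cut-off, which is
only `C¹` and may have `0` in its closed support, is admitted by
`integral_deriv_mul_eq_of_forall_test`. The balance is `IsLerayHopf.mul_integral_cutoff_le`, its
averaged form `IsLerayHopf.cutoffMean_mul_normA_sq_le`, and the concluding algebra
`lower_bound_of_quadratic`.

The existence of a universal Agmon constant (`isAgmonConstant`) is separate: the sup norm is at most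
the ℓ¹ norm of the Fourier coefficients, which a weighted Cauchy–Schwarz inequality and a lattice
sum control. -/

namespace PeriodicNSE

/-! ### Fourier analysis on the box, transferred from the unit torus -/

section TorusTransfer

open UnitAddTorus ComplexConjugate

attribute [local instance] instMeasureSpaceUnitAddCircle

/-- The parametrization of the periodic box by the unit torus. -/
def toBox (L : ℝ) (y : UnitAddTorus (Fin 3)) : E3 :=
  L • WithLp.toLp 2 ((measurableEquivPiIoc (fun _ => (0 : ℝ)) y).1)

/-- The exponential `exp (2πi k·x/L)`. -/
def expMode (L : ℝ) (k : Fin 3 → ℤ) (x : E3) : ℂ :=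
  Complex.exp ((2 * (Real.pi : ℂ) * Complex.I / (L : ℂ)) * ∑ i, (k i : ℂ) * ((x i : ℝ) : ℂ))

lemma measurableSet_box (L : ℝ) : MeasurableSet (box L) := by
  have : box L = ⋂ i, {x : E3 | x i ∈ Icc (0 : ℝ) L} := by ext; simp [box]
  rw [this]
  exact MeasurableSet.iInter fun i =>
    (show Measurable fun x : E3 => x i by fun_prop) measurableSet_Icc

lemma box_eq_preimage (L : ℝ) :
    box L = WithLp.ofLp ⁻¹' (Icc (fun _ => (0 : ℝ)) (fun _ => L)) := by
  ext x
  simp [box, Pi.le_def, forall_and]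

lemma isCompact_box (L : ℝ) : IsCompact (box L) := by
  have h := (isCompact_Icc (a := fun _ : Fin 3 => (0 : ℝ)) (b := fun _ => L)).image
    (PiLp.continuous_toLp 2 (fun _ : Fin 3 => ℝ))
  convert h using 1
  rw [box_eq_preimage]
  ext x
  constructor
  · intro hx; exact ⟨_, hx, rfl⟩
  · rintro ⟨y, hy, rfl⟩; exact hy

instance (L : ℝ) : IsFiniteMeasure ((volume : Measure E3).restrict (box L)) :=
  ⟨by simpa using (isCompact_box L).measure_lt_top⟩

/-- The torus carries normalised Haar measure, hence the factor `(L ^ 3)⁻¹`; the half-open cell of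
the parametrization differs from the closed box by a null set. Parseval's identity and Fourier
series reach the box through this map. -/
lemma measurePreserving_toBox {L : ℝ} (hL : 0 < L) :
    MeasurePreserving (toBox L) volume
      (ENNReal.ofReal ((L ^ 3)⁻¹) • (volume : Measure E3).restrict (box L)) := by
  have h1 := measurePreserving_equivPiIoc (d := Fin 3) (fun _ => (0 : ℝ))
  set s : Set (Fin 3 → ℝ) := {x | ∀ i, x i ∈ Ioc (0 : ℝ) (0 + 1)} with hs
  have hsm : MeasurableSet s := MeasurableSet.univ_pi' (fun i => measurableSet_Ioc)
  have h2 : MeasurePreserving (Subtype.val : s → (Fin 3 → ℝ)) (Measure.comap Subtype.val volume)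
      (volume.restrict s) := ⟨measurable_subtype_coe, map_comap_subtype_coe hsm volume⟩
  have hst : (volume : Measure (Fin 3 → ℝ)).restrict s
      = volume.restrict (Icc (fun _ => (0 : ℝ)) (fun _ => 1)) := by
    refine Measure.restrict_congr_set ?_
    have := Measure.univ_pi_Ioc_ae_eq_Icc (μ := fun _ : Fin 3 => (volume : Measure ℝ))
      (f := fun _ => (0 : ℝ)) (g := fun _ => 1)
    have hs' : s = univ.pi fun _ => Ioc (0 : ℝ) 1 := by ext x; simp [hs]
    rw [hs']
    exact this
  rw [hst] at h2
  have h3 : MeasurePreserving (WithLp.toLp 2 : (Fin 3 → ℝ) → E3)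
      (volume.restrict (Icc (fun _ => (0 : ℝ)) (fun _ => 1))) (volume.restrict (box 1)) := by
    have := (PiLp.volume_preserving_toLp (Fin 3)).restrict_preimage (measurableSet_box 1)
    rw [box_eq_preimage] at this ⊢
    exact this
  have h4 : MeasurePreserving (fun x : E3 => L • x) (volume.restrict (box 1))
      (ENNReal.ofReal ((L ^ 3)⁻¹) • (volume : Measure E3).restrict (box L)) := by
    have h := Measure.map_addHaar_smul (volume : Measure E3) hL.ne'
    have hp : MeasurePreserving (fun x : E3 => L • x) volume
        (ENNReal.ofReal ((L ^ 3)⁻¹) • volume) := by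
      refine ⟨by fun_prop, ?_⟩
      rw [h]
      simp [abs_of_pos hL]
    have := hp.restrict_preimage (measurableSet_box L)
    rw [Measure.restrict_smul] at this
    convert this using 2
    ext x
    simp only [box, mem_ofPred_eq, mem_preimage, PiLp.smul_apply, smul_eq_mul, mem_Icc]
    refine forall_congr' fun i => ?_
    constructor
    · rintro ⟨h1, h2⟩; exact ⟨by positivity, by nlinarith⟩
    · rintro ⟨h1, h2⟩; exact ⟨by by_contra h; nlinarith, by by_contra h; nlinarith⟩
  exact h4.comp (h3.comp (h2.comp h1))

lemma mFourier_eq_expMode_toBox {L : ℝ} (hL : 0 < L) (k : Fin 3 → ℤ)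
    (y : UnitAddTorus (Fin 3)) : mFourier k y = expMode L k (toBox L y) := by
  obtain ⟨z, rfl⟩ := (measurableEquivPiIoc (fun _ : Fin 3 => (0 : ℝ))).symm.surjective y
  simp only [toBox, MeasurableEquiv.apply_symm_apply]
  simp only [mFourier, ContinuousMap.coe_mk, expMode, Finset.mul_sum, Complex.exp_sum,
    coe_symm_measurableEquivPiIoc_apply, fourier_coe_apply]
  refine Finset.prod_congr rfl fun i _ => ?_
  congr 1
  have : (L : ℂ) ≠ 0 := by exact_mod_cast hL.ne'
  simp only [PiLp.smul_apply, smul_eq_mul, Complex.ofReal_mul, Complex.ofReal_one]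
  field_simp

lemma integral_toBox {E : Type*} [NormedAddCommGroup E] [NormedSpace ℝ E] {L : ℝ} (hL : 0 < L)
    {F : E3 → E} (hF : AEStronglyMeasurable F (volume.restrict (box L))) :
    ∫ y, F (toBox L y) = (L ^ 3)⁻¹ • ∫ x in box L, F x := by
  have h := measurePreserving_toBox hL
  have h' := integral_map (μ := volume) h.measurable.aemeasurable (f := F)
    (by rw [h.map_eq]; exact hF.smul_measure _)
  rw [← h', h.map_eq, integral_smul_measure, ENNReal.toReal_ofReal (by positivity)]

lemma expMode_neg (L : ℝ) (k : Fin 3 → ℤ) (x : E3) :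
    expMode L (-k) x = conj (expMode L k x) := by
  simp only [expMode, ← Complex.exp_conj]
  congr 1
  simp [Complex.conj_ofReal, Complex.conj_ofNat]
  ring

lemma continuous_expMode (L : ℝ) (k : Fin 3 → ℤ) : Continuous (expMode L k) := by
  unfold expMode
  fun_prop

lemma norm_expMode (L : ℝ) (k : Fin 3 → ℤ) (x : E3) : ‖expMode L k x‖ = 1 := by
  have : expMode L k x
      = Complex.exp (((2 * Real.pi / L * ∑ i, (k i : ℝ) * x i : ℝ) : ℂ) * Complex.I) := by
    unfold expMode; congr 1; push_cast; ring
  rw [this, Complex.norm_exp_ofReal_mul_I]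

lemma fourierCoef_eq_expMode (L : ℝ) (w : E3 → E3) (k : Fin 3 → ℤ) (j : Fin 3) :
    fourierCoef L w k j
      = ((L : ℂ) ^ 3)⁻¹ * ∫ x in box L, ((w x j : ℝ) : ℂ) * expMode L (-k) x := by
  unfold fourierCoef expMode
  congr 2
  ext x
  congr 2
  simp [Finset.mul_sum]

lemma memLp_coord {L : ℝ} {w : E3 → E3} (hw : MemLp w 2 (volume.restrict (box L))) (j : Fin 3) :
    MemLp (fun x => ((w x j : ℝ) : ℂ)) 2 (volume.restrict (box L)) := by
  have h : MemLp (fun x => w x j) 2 (volume.restrict (box L)) := by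
    refine hw.of_le (by
      exact (PiLp.continuous_apply 2 (fun _ : Fin 3 => ℝ) j).comp_aestronglyMeasurable hw.1) ?_
    exact Filter.Eventually.of_forall fun x => PiLp.norm_apply_le (w x) j
  exact h.ofReal

lemma memLp_coord_toBox {L : ℝ} (hL : 0 < L) {w : E3 → E3}
    (hw : MemLp w 2 (volume.restrict (box L))) (j : Fin 3) :
    MemLp (fun y => ((w (toBox L y) j : ℝ) : ℂ)) 2 volume :=
  ((memLp_coord hw j).smul_measure ENNReal.ofReal_ne_top).comp_measurePreserving
    (measurePreserving_toBox hL)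

lemma fourierCoef_eq_mFourierCoeff {L : ℝ} (hL : 0 < L) {w : E3 → E3}
    (hw : MemLp w 2 (volume.restrict (box L))) (k : Fin 3 → ℤ) (j : Fin 3) :
    fourierCoef L w k j = mFourierCoeff (fun y => ((w (toBox L y) j : ℝ) : ℂ)) k := by
  rw [fourierCoef_eq_expMode, mFourierCoeff]
  simp_rw [mFourier_eq_expMode_toBox hL]
  rw [integral_toBox hL (F := fun x => expMode L (-k) x • ((w x j : ℝ) : ℂ))]
  · simp [mul_comm, Complex.real_smul]
  · exact (continuous_expMode L _).aestronglyMeasurable.smul (memLp_coord hw j).1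

lemma mFourierCoeff_congr_ae {g h : UnitAddTorus (Fin 3) → ℂ} (hgh : g =ᵐ[volume] h)
    (k : Fin 3 → ℤ) : mFourierCoeff g k = mFourierCoeff h k := by
  refine integral_congr_ae ?_
  filter_upwards [hgh] with y hy
  rw [hy]

/-- Parseval's identity on the box, componentwise. -/
lemma hasSum_fourierCoef_mul_conj_coord {L : ℝ} (hL : 0 < L) {w v : E3 → E3}
    (hw : MemLp w 2 (volume.restrict (box L))) (hv : MemLp v 2 (volume.restrict (box L)))
    (j : Fin 3) :
    HasSum (fun k => (fourierCoef L w k j * conj (fourierCoef L v k j)).re)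
      ((L ^ 3)⁻¹ * ∫ x in box L, w x j * v x j) := by
  have hw' := memLp_coord_toBox hL hw j
  have hv' := memLp_coord_toBox hL hv j
  have h := hasSum_prod_mFourierCoeff (hv'.toLp _) (hw'.toLp _)
  have e1 : ∀ k, mFourierCoeff (hw'.toLp _) k = fourierCoef L w k j := fun k => by
    rw [fourierCoef_eq_mFourierCoeff hL hw]; exact mFourierCoeff_congr_ae hw'.coeFn_toLp k
  have e2 : ∀ k, mFourierCoeff (hv'.toLp _) k = fourierCoef L v k j := fun k => by
    rw [fourierCoef_eq_mFourierCoeff hL hv]; exact mFourierCoeff_congr_ae hv'.coeFn_toLp k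
  simp only [e1, e2] at h
  have e3 : ∫ t, conj (hv'.toLp _ t) * hw'.toLp _ t
      = (((L ^ 3)⁻¹ * ∫ x in box L, w x j * v x j : ℝ) : ℂ) := by
    have : ∫ t, conj (hv'.toLp _ t) * hw'.toLp _ t
        = ∫ t, (fun x => (((w x j * v x j : ℝ)) : ℂ)) (toBox L t) := by
      refine integral_congr_ae ?_
      filter_upwards [hw'.coeFn_toLp, hv'.coeFn_toLp] with y h1 h2
      rw [h1, h2, Complex.conj_ofReal]; push_cast; ring
    rw [this, integral_toBox hL (F := fun x => (((w x j * v x j : ℝ)) : ℂ)),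
      integral_complex_ofReal]
    · simp
    · have := (memLp_coord hw j).1.mul (memLp_coord hv j).1
      refine this.congr (Filter.Eventually.of_forall fun x => ?_)
      simp
  rw [e3] at h
  have h' := Complex.hasSum_re h
  rw [Complex.ofReal_re] at h'
  simpa only [mul_comm] using h'

lemma integrable_coord_mul_coord {L : ℝ} {w v : E3 → E3}
    (hw : MemLp w 2 (volume.restrict (box L))) (hv : MemLp v 2 (volume.restrict (box L)))
    (j : Fin 3) : Integrable (fun x => w x j * v x j) (volume.restrict (box L)) := by
  have h := MemLp.integrable_mul (memLp_coord hw j) (memLp_coord hv j)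
  have := h.re
  refine this.congr (Filter.Eventually.of_forall fun x => ?_)
  simp

lemma innerL2_eq_sum {L : ℝ} {w v : E3 → E3}
    (hw : MemLp w 2 (volume.restrict (box L))) (hv : MemLp v 2 (volume.restrict (box L))) :
    innerL2 L w v = ∑ j, ∫ x in box L, w x j * v x j := by
  rw [← integral_finsetSum _ fun j _ => integrable_coord_mul_coord hw hv j]
  refine integral_congr_ae (Filter.Eventually.of_forall fun x => ?_)
  simp [PiLp.inner_apply, mul_comm]

/-- Parseval's identity on the box. -/
lemma hasSum_fourierCoef_mul_conj {L : ℝ} (hL : 0 < L) {w v : E3 → E3}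
    (hw : MemLp w 2 (volume.restrict (box L))) (hv : MemLp v 2 (volume.restrict (box L))) :
    HasSum (fun k => ∑ j, (fourierCoef L w k j * conj (fourierCoef L v k j)).re)
      ((L ^ 3)⁻¹ * innerL2 L w v) := by
  rw [innerL2_eq_sum hw hv, Finset.mul_sum]
  exact hasSum_sum fun j _ => hasSum_fourierCoef_mul_conj_coord hL hw hv j

lemma normL2_sq (L : ℝ) (w : E3 → E3) : normL2 L w ^ 2 = innerL2 L w w := by
  rw [normL2, Real.sq_sqrt (integral_nonneg fun x => by positivity), innerL2]
  simp

lemma normL2_nonneg (L : ℝ) (w : E3 → E3) : 0 ≤ normL2 L w := Real.sqrt_nonneg _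

lemma hasSum_fourierCoef_sq {L : ℝ} (hL : 0 < L) {w : E3 → E3}
    (hw : MemLp w 2 (volume.restrict (box L))) :
    HasSum (fun k => ∑ j, ‖fourierCoef L w k j‖ ^ 2) ((L ^ 3)⁻¹ * normL2 L w ^ 2) := by
  rw [normL2_sq]
  convert hasSum_fourierCoef_mul_conj hL hw hw using 5 with k j
  rw [Complex.mul_conj, Complex.ofReal_re, Complex.normSq_eq_norm_sq]

/-- A component with absolutely summable Fourier coefficients is a.e. bounded by their sum. -/
lemma ae_abs_coord_le_tsum {L : ℝ} (hL : 0 < L) {w : E3 → E3}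
    (hw : MemLp w 2 (volume.restrict (box L))) (j : Fin 3)
    (hs : Summable fun k => ‖fourierCoef L w k j‖) :
    ∀ᵐ x ∂(volume.restrict (box L)), |w x j| ≤ ∑' k, ‖fourierCoef L w k j‖ := by
  have : IsProbabilityMeasure (volume : Measure UnitAddCircle) :=
    inferInstanceAs (IsProbabilityMeasure AddCircle.haarAddCircle)
  have hw' := memLp_coord_toBox hL hw j
  have h := hasSum_mFourier_series_L2 (hw'.toLp _)
  have e1 : ∀ k, mFourierCoeff (hw'.toLp _) k = fourierCoef L w k j := fun k => by
    rw [fourierCoef_eq_mFourierCoeff hL hw]; exact mFourierCoeff_congr_ae hw'.coeFn_toLp k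
  simp only [e1] at h
  have hs' : Summable fun k => fourierCoef L w k j • (mFourier k : C(UnitAddTorus (Fin 3), ℂ)) := by
    refine Summable.of_norm ?_
    simpa [norm_smul, mFourier_norm] using hs
  set g := ∑' k, fourierCoef L w k j • (mFourier k : C(UnitAddTorus (Fin 3), ℂ)) with hg
  have hgL := (ContinuousMap.toLp (E := ℂ) 2 (volume : Measure (UnitAddTorus (Fin 3))) ℂ).hasSum
    hs'.hasSum
  simp only [map_smul] at hgL
  -- The Fourier series converges to the component of `w` in L² and, being absolutely summable,
  -- uniformly to `g`; the two limits therefore agree a.e.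
  have heq := h.unique hgL
  have hbound : ‖g‖ ≤ ∑' k, ‖fourierCoef L w k j‖ := by
    refine (norm_tsum_le_tsum_norm (by simpa [norm_smul, mFourier_norm] using hs)).trans_eq ?_
    simp [norm_smul, mFourier_norm]
  have hae : ∀ᵐ y ∂(volume : Measure (UnitAddTorus (Fin 3))),
      |w (toBox L y) j| ≤ ∑' k, ‖fourierCoef L w k j‖ := by
    filter_upwards [hw'.coeFn_toLp, ContinuousMap.coeFn_toLp (𝕜 := ℂ) (p := 2)
      (volume : Measure (UnitAddTorus (Fin 3))) g] with y h1 h2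
    rw [heq, h2] at h1
    have : ‖g y‖ ≤ ‖g‖ := g.norm_coe_le_norm y
    rw [h1] at this
    simpa using this.trans hbound
  have hmp := measurePreserving_toBox hL
  -- `ae_map_iff` needs a measurable set, so the bound is pushed forward for a measurable
  -- representative.
  have hwm : AEStronglyMeasurable (fun x => w x j) (volume.restrict (box L)) :=
    (PiLp.continuous_apply 2 (fun _ : Fin 3 => ℝ) j).comp_aestronglyMeasurable hw.1
  have hc : ENNReal.ofReal ((L ^ 3)⁻¹) ≠ 0 := by
    simp only [ne_eq, ENNReal.ofReal_eq_zero, not_le]; positivity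
  have hmk : ∀ᵐ x ∂(ENNReal.ofReal ((L ^ 3)⁻¹) • (volume : Measure E3).restrict (box L)),
      w x j = hwm.mk _ x := Measure.ae_smul_measure hwm.ae_eq_mk _
  have hmk' := hmp.quasiMeasurePreserving.ae hmk
  have h3 : ∀ᵐ x ∂(Measure.map (toBox L) volume),
      |hwm.mk _ x| ≤ ∑' k, ‖fourierCoef L w k j‖ := by
    rw [ae_map_iff hmp.measurable.aemeasurable
      (measurableSet_le hwm.stronglyMeasurable_mk.measurable.abs measurable_const)]
    filter_upwards [hae, hmk'] with y h1 h2
    rwa [h2] at h1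
  rw [hmp.map_eq, Measure.ae_ennreal_smul_measure_iff hc] at h3
  filter_upwards [h3, hwm.ae_eq_mk] with x h1 h2
  rwa [h2]

/-- Orthogonality of the exponentials on the box. -/
lemma integral_expMode_mul_expMode_neg {L : ℝ} (hL : 0 < L) (k m : Fin 3 → ℤ) :
    ((L : ℂ) ^ 3)⁻¹ * ∫ x in box L, expMode L k x * expMode L (-m) x = if k = m then 1 else 0 := by
  have : IsProbabilityMeasure (volume : Measure UnitAddCircle) :=
    inferInstanceAs (IsProbabilityMeasure AddCircle.haarAddCircle)
  have h := orthonormal_iff_ite.mp (orthonormal_mFourier (d := Fin 3)) m k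
  simp only [ContinuousMap.inner_toLp] at h
  have h2 := integral_toBox hL (F := fun x => expMode L k x * expMode L (-m) x)
    ((continuous_expMode L k).mul (continuous_expMode L _)).aestronglyMeasurable
  simp only [Complex.real_smul, Complex.ofReal_inv, Complex.ofReal_pow] at h2
  rw [← h2]
  simp only [← mFourier_eq_expMode_toBox hL, mFourier_neg]
  rw [h]
  simp [eq_comm]

end TorusTransfer

/-! ### Agmon's inequality with a period-independent constant -/

section Agmon

open ComplexConjugate

/-- The squared Euclidean length of a frequency. -/
def freqSq (k : Fin 3 → ℤ) : ℝ := ∑ i, (k i : ℝ) ^ 2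

/-- The sup norm of a frequency. -/
def freqSup (k : Fin 3 → ℤ) : ℕ := Finset.univ.sup fun i => (k i).natAbs

lemma freqSup_sq_le (k : Fin 3 → ℤ) : (freqSup k : ℝ) ^ 2 ≤ freqSq k := by
  obtain ⟨i, -, hi⟩ := Finset.exists_mem_eq_sup Finset.univ Finset.univ_nonempty
    fun i => (k i).natAbs
  have : (freqSup k : ℝ) ^ 2 = (k i : ℝ) ^ 2 := by
    rw [freqSup, hi]
    rw [Nat.cast_natAbs]
    push_cast
    exact sq_abs _
  rw [this, freqSq]
  exact Finset.single_le_sum (f := fun i => (k i : ℝ) ^ 2) (fun _ _ => sq_nonneg _)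
    (Finset.mem_univ i)

lemma freqSup_pos {k : Fin 3 → ℤ} (hk : k ≠ 0) : 0 < freqSup k := by
  obtain ⟨i, hi⟩ := Function.ne_iff.mp hk
  exact (Int.natAbs_pos.mpr hi).trans_le
    (Finset.le_sup (f := fun i => (k i).natAbs) (Finset.mem_univ i))

lemma one_le_freqSq {k : Fin 3 → ℤ} (hk : k ≠ 0) : 1 ≤ freqSq k := by
  refine le_trans ?_ (freqSup_sq_le k)
  have : (1 : ℝ) ≤ freqSup k := by exact_mod_cast freqSup_pos hk
  nlinarith

/-- The number of frequencies in a finite set lying on a shell of the sup norm. -/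
lemma card_filter_freqSup_le (S : Finset (Fin 3 → ℤ)) (n : ℕ) :
    ((S.filter fun k => freqSup k = n + 1).card : ℝ) ≤ 26 * ((n : ℝ) + 1) ^ 2 := by
  set Q : ℕ → Finset (Fin 3 → ℤ) :=
    fun m => Fintype.piFinset fun _ => Finset.Icc (-(m : ℤ)) m with hQ
  have hcard : ∀ m, ((Q m).card : ℤ) = (2 * m + 1) ^ 3 := fun m => by
    simp only [hQ, Fintype.card_piFinset, Int.card_Icc, Finset.prod_const, Finset.card_univ,
      Fintype.card_fin]
    push_cast
    congr 1
    omega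
  have hsub : Q n ⊆ Q (n + 1) := by
    intro k hk
    simp only [hQ, Fintype.mem_piFinset, Finset.mem_Icc] at hk ⊢
    intro i
    have := hk i
    push_cast
    omega
  have hle : (S.filter fun k => freqSup k = n + 1) ⊆ Q (n + 1) \ Q n := by
    intro k hk
    have hk' := (Finset.mem_filter.mp hk).2
    rw [Finset.mem_sdiff]
    constructor
    · simp only [hQ, Fintype.mem_piFinset, Finset.mem_Icc]
      intro i
      have := Finset.le_sup (f := fun i => (k i).natAbs) (Finset.mem_univ i)
      change (k i).natAbs ≤ freqSup k at this
      omega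
    · intro h
      simp only [hQ, Fintype.mem_piFinset, Finset.mem_Icc] at h
      have : freqSup k ≤ n := Finset.sup_le fun i _ => by have := h i; omega
      omega
  have h1 := Finset.card_le_card hle
  rw [Finset.card_sdiff_of_subset hsub] at h1
  have h2 : ((Q (n + 1)).card - (Q n).card : ℕ) = ((Q (n + 1)).card : ℤ) - (Q n).card :=
    Nat.cast_sub (Finset.card_le_card hsub)
  -- With `m = n + 1` the shell has `(2m+1)³ - (2m-1)³ = 24m² + 2 ≤ 26m²` points.
  have h3 : ((S.filter fun k => freqSup k = n + 1).card : ℤ) ≤ 26 * ((n : ℤ) + 1) ^ 2 := by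
    refine (Int.ofNat_le.mpr h1).trans ?_
    rw [h2, hcard, hcard]
    push_cast
    nlinarith [Int.natCast_nonneg n]
  exact_mod_cast h3

/-- Lattice sum behind the three-dimensional Agmon inequality. -/
lemma sum_inv_freqSq_le {M : ℝ} (hM : 0 < M) (S : Finset (Fin 3 → ℤ)) (hS : 0 ∉ S) :
    ∑ k ∈ S, 1 / (freqSq k * (M ^ 2 + freqSq k)) ≤ 52 / M := by
  obtain ⟨B, hB⟩ : ∃ B, ∀ k ∈ S, freqSup k - 1 ∈ Finset.range B :=
    ⟨S.sup freqSup, fun k hk => Finset.mem_range.mpr (by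
      have := Finset.le_sup (f := freqSup) hk
      have := freqSup_pos (fun h : k = 0 => hS (h ▸ hk))
      omega)⟩
  have hpos : ∀ k ∈ S, 0 < freqSup k := fun k hk =>
    freqSup_pos (fun h : k = 0 => hS (h ▸ hk))
  calc ∑ k ∈ S, 1 / (freqSq k * (M ^ 2 + freqSq k))
      ≤ ∑ k ∈ S, 1 / ((freqSup k : ℝ) ^ 2 * (M ^ 2 + (freqSup k : ℝ) ^ 2)) := by
        refine Finset.sum_le_sum fun k hk => ?_
        have h1 := freqSup_sq_le k
        have h2 : (0 : ℝ) < freqSup k := by exact_mod_cast hpos k hk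
        have h3 := (sq_nonneg (freqSup k : ℝ)).trans h1
        gcongr
    _ = ∑ n ∈ Finset.range B, ∑ k ∈ S with freqSup k - 1 = n,
          1 / ((freqSup k : ℝ) ^ 2 * (M ^ 2 + (freqSup k : ℝ) ^ 2)) :=
        (Finset.sum_fiberwise_of_maps_to hB _).symm
    _ ≤ ∑ n ∈ Finset.range B, (52 / (M + n) - 52 / (M + (n + 1 : ℕ))) := by
        refine Finset.sum_le_sum fun n _ => ?_
        have hf : (S.filter fun k => freqSup k - 1 = n) = S.filter fun k => freqSup k = n + 1 := by
          refine Finset.filter_congr fun k hk => ?_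
          have := hpos k hk
          omega
        rw [hf]
        have hc : ∀ k ∈ S.filter fun k => freqSup k = n + 1,
            1 / ((freqSup k : ℝ) ^ 2 * (M ^ 2 + (freqSup k : ℝ) ^ 2))
              = 1 / (((n : ℝ) + 1) ^ 2 * (M ^ 2 + ((n : ℝ) + 1) ^ 2)) := fun k hk => by
          rw [(Finset.mem_filter.mp hk).2]; push_cast; rfl
        rw [Finset.sum_congr rfl hc, Finset.sum_const, nsmul_eq_mul]
        have hn : (0 : ℝ) ≤ n := Nat.cast_nonneg n
        calc _ ≤ 26 * ((n : ℝ) + 1) ^ 2 * (1 / (((n : ℝ) + 1) ^ 2 * (M ^ 2 + ((n : ℝ) + 1) ^ 2))) :=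
              mul_le_mul_of_nonneg_right (card_filter_freqSup_le S n) (by positivity)
          _ = 26 / (M ^ 2 + ((n : ℝ) + 1) ^ 2) := by field_simp
          -- `(M+n)(M+n+1) ≤ (M+n+1)² ≤ 2(M² + (n+1)²)`, and the new denominator makes the sum
          -- telescope.
          _ ≤ 52 / ((M + n) * (M + (n + 1))) := by
              rw [div_le_div_iff₀ (by positivity) (by positivity)]
              nlinarith [sq_nonneg (M - (n + 1))]
          _ = _ := by push_cast; field_simp; ring
    _ = 52 / (M + (0 : ℕ)) - 52 / (M + B) :=
        Finset.sum_range_sub' (fun n : ℕ => 52 / (M + n)) B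
    _ ≤ 52 / M := by
        have : 0 ≤ 52 / (M + B) := by positivity
        simp only [Nat.cast_zero, add_zero]
        linarith

/-- Interpolation bound for absolute sums of Fourier coefficients. -/
lemma sum_sq_le_of_weighted_sums {a : (Fin 3 → ℤ) → ℝ} {X Y : ℝ}
    (S : Finset (Fin 3 → ℤ)) (hS : 0 ∉ S)
    (hX : ∑ k ∈ S, freqSq k * a k ^ 2 ≤ X) (hY : ∑ k ∈ S, freqSq k ^ 2 * a k ^ 2 ≤ Y) :
    (∑ k ∈ S, a k) ^ 2 ≤ 104 * (√X * √Y) := by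
  have hq : ∀ k ∈ S, 1 ≤ freqSq k := fun k hk => one_le_freqSq fun h => hS (h ▸ hk)
  by_cases hz : ∀ k ∈ S, a k = 0
  · rw [Finset.sum_eq_zero hz, zero_pow two_ne_zero]; positivity
  push Not at hz
  obtain ⟨m, hm, hma⟩ := hz
  have hXpos : 0 < X := lt_of_lt_of_le (Finset.sum_pos' (fun k hk => by
    have := hq k hk; positivity) ⟨m, hm, by have := hq m hm; positivity⟩) hX
  have hYpos : 0 < Y := lt_of_lt_of_le (Finset.sum_pos' (fun k hk => by
    have := hq k hk; positivity) ⟨m, hm, by have := hq m hm; positivity⟩) hY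
  have hsX := Real.sqrt_pos.mpr hXpos
  have hsY := Real.sqrt_pos.mpr hYpos
  have hX2 := Real.sq_sqrt hXpos.le
  have hY2 := Real.sq_sqrt hYpos.le
  set x := √X
  set y := √Y
  -- Cauchy–Schwarz with weights whose product `f k * g k` is exactly `a k ^ 2`. The crossover
  -- frequency `y / x` is chosen so that the two halves of `g` each sum to at most 1.
  have hCS := Finset.sum_sq_le_sum_mul_sum_of_sq_le_mul S (r := a)
    (f := fun k => y ^ 2 * (1 / (freqSq k * ((y / x) ^ 2 + freqSq k))))
    (g := fun k => 1 / x ^ 2 * (freqSq k * a k ^ 2) + 1 / y ^ 2 * (freqSq k ^ 2 * a k ^ 2))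
    (fun k hk => by have := hq k hk; positivity) (fun k hk => by have := hq k hk; positivity)
    (fun k hk => by
      have := hq k hk
      refine le_of_eq ?_
      field_simp)
  refine hCS.trans ?_
  rw [← Finset.mul_sum, Finset.sum_add_distrib, ← Finset.mul_sum, ← Finset.mul_sum]
  have h1 := sum_inv_freqSq_le (M := y / x) (by positivity) S hS
  have h2 : 1 / x ^ 2 * ∑ k ∈ S, freqSq k * a k ^ 2 ≤ 1 := by
    rw [one_div, inv_mul_le_one₀ (by positivity), hX2]; exact hX
  have h3 : 1 / y ^ 2 * ∑ k ∈ S, freqSq k ^ 2 * a k ^ 2 ≤ 1 := by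
    rw [one_div, inv_mul_le_one₀ (by positivity), hY2]; exact hY
  calc _ ≤ (y ^ 2 * (52 / (y / x))) * 2 := by
        refine mul_le_mul (by gcongr) (by linarith) ?_ (by positivity)
        refine add_nonneg (mul_nonneg (by positivity) (Finset.sum_nonneg fun k hk => ?_))
          (mul_nonneg (by positivity) (Finset.sum_nonneg fun k hk => ?_)) <;>
        · have := hq k hk; positivity
    _ = 104 * (x * y) := by field_simp; ring

lemma eigenval_eq (L : ℝ) (k : Fin 3 → ℤ) : eigenval L k = (2 * Real.pi / L) ^ 2 * freqSq k := rfl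

lemma eigenval_nonneg (L : ℝ) (k : Fin 3 → ℤ) : 0 ≤ eigenval L k := by
  rw [eigenval_eq, freqSq]; positivity

lemma eigenval_zero (L : ℝ) : eigenval L 0 = 0 := by simp [eigenval]

lemma eigenval_pos {L : ℝ} (hL : 0 < L) {k : Fin 3 → ℤ} (hk : k ≠ 0) : 0 < eigenval L k := by
  have := one_le_freqSq hk
  rw [eigenval_eq]; positivity

lemma fourierCoef_zero {L : ℝ} {w : E3 → E3} (hw : MemH L w) (j : Fin 3) :
    fourierCoef L w 0 j = 0 := by
  have hi : Integrable w (volume.restrict (box L)) := hw.memLp.integrable (by norm_num)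
  have h := congrArg (fun z : E3 => z j) hw.meanZero
  have h2 : ∫ x in box L, w x j = 0 := by
    have := (EuclideanSpace.proj (𝕜 := ℝ) j).integral_comp_comm hi
    simpa using this.trans h
  simp [fourierCoef, integral_complex_ofReal, h2]

lemma normA_nonneg (L s : ℝ) (w : E3 → E3) : 0 ≤ normA L s w := Real.sqrt_nonneg _

lemma normA_sq {L : ℝ} (hL : 0 < L) (s : ℝ) (w : E3 → E3) :
    normA L s w ^ 2 = L ^ 3 * ∑' k : Fin 3 → ℤ,
      eigenval L k ^ (2 * s) * ∑ j, ‖fourierCoef L w k j‖ ^ 2 := by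
  rw [normA, Real.sq_sqrt]
  refine mul_nonneg (by positivity) (tsum_nonneg fun k => ?_)
  have := eigenval_nonneg L k
  positivity

lemma sum_eigenval_mul_le_normA_sq {L s : ℝ} (hL : 0 < L) {w : E3 → E3}
    (hs : Summable fun k : Fin 3 → ℤ => eigenval L k ^ (2 * s) * ∑ j, ‖fourierCoef L w k j‖ ^ 2)
    (S : Finset (Fin 3 → ℤ)) :
    L ^ 3 * ∑ k ∈ S, eigenval L k ^ (2 * s) * ∑ j, ‖fourierCoef L w k j‖ ^ 2
      ≤ normA L s w ^ 2 := by
  rw [normA_sq hL]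
  refine mul_le_mul_of_nonneg_left (hs.sum_le_tsum S fun k _ => ?_) (by positivity)
  have := eigenval_nonneg L k
  positivity

/-- `D(A^s)` decreases in `s`. -/
lemma MemDomA.half_of_one {L : ℝ} (hL : 0 < L) {w : E3 → E3} (hw : MemDomA L 1 w) :
    Summable fun k : Fin 3 → ℤ =>
      eigenval L k ^ (2 * (1 / 2) : ℝ) * ∑ j, ‖fourierCoef L w k j‖ ^ 2 := by
  -- Spectral gap: nonzero eigenvalues are at least `(2π/L)²`, so `λ ≤ λ² / (2π/L)²`.
  refine Summable.of_nonneg_of_le (fun k => ?_) (fun k => ?_)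
    (hw.2.mul_left (((2 * Real.pi / L) ^ 2)⁻¹))
  · have := eigenval_nonneg L k; positivity
  · rcases eq_or_ne k 0 with rfl | hk
    · simp [eigenval_zero]
    · have h1 := one_le_freqSq hk
      rw [← mul_assoc]
      refine mul_le_mul_of_nonneg_right ?_ (by positivity)
      have e1 : eigenval L k ^ (2 * (1 / 2) : ℝ) = eigenval L k := by norm_num
      have e2 : eigenval L k ^ (2 * 1 : ℝ) = eigenval L k ^ 2 := by
        rw [mul_one]; exact_mod_cast Real.rpow_natCast _ 2
      rw [e1, e2, eigenval_eq]
      have : 0 < (2 * Real.pi / L) ^ 2 := by positivity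
      rw [le_inv_mul_iff₀ this]
      nlinarith [mul_pos this this]

/-- Agmon's inequality with a constant independent of the period. -/
theorem isAgmonConstant {L : ℝ} (hL : 0 < L) : IsAgmonConstant L 18 := by
  refine ⟨by norm_num, fun w hw => ?_⟩
  have hhalf := hw.half_of_one hL
  set N := normA L (1 / 2) w with hN
  set P := normA L 1 w with hP
  have hN0 : 0 ≤ N := normA_nonneg _ _ _
  have hP0 : 0 ≤ P := normA_nonneg _ _ _
  set κ := 2 * Real.pi / L with hκ
  have hκ0 : 0 < κ := by positivity
  -- The period survives in the estimate only through powers of `L * κ = 2π`, which is why the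
  -- constant does not depend on it.
  have hκL : 1 ≤ L * κ := by
    have : L * κ = 2 * Real.pi := by rw [hκ]; field_simp
    rw [this]; linarith [Real.pi_gt_three]
  have key : ∀ (j : Fin 3) (S : Finset (Fin 3 → ℤ)),
      (∑ k ∈ S, ‖fourierCoef L w k j‖) ^ 2 ≤ 104 * (N * P) := by
    intro j S
    have hSz : ∑ k ∈ S, ‖fourierCoef L w k j‖ = ∑ k ∈ S.erase 0, ‖fourierCoef L w k j‖ := by
      rw [Finset.sum_erase]
      simp [fourierCoef_zero hw.1]
    have hle : ∀ k, ‖fourierCoef L w k j‖ ^ 2 ≤ ∑ j, ‖fourierCoef L w k j‖ ^ 2 := fun k =>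
      Finset.single_le_sum (f := fun j => ‖fourierCoef L w k j‖ ^ 2)
        (fun _ _ => sq_nonneg _) (Finset.mem_univ j)
    have hq0 : ∀ k, 0 ≤ freqSq k := fun k => by unfold freqSq; positivity
    have hX : ∑ k ∈ S.erase 0, freqSq k * ‖fourierCoef L w k j‖ ^ 2
        ≤ N ^ 2 / (L ^ 3 * κ ^ 2) := by
      rw [le_div_iff₀ (by positivity)]
      refine le_trans ?_ (sum_eigenval_mul_le_normA_sq hL hhalf (S.erase 0))
      rw [mul_comm, mul_assoc, Finset.mul_sum]
      refine mul_le_mul_of_nonneg_left (Finset.sum_le_sum fun k _ => ?_) (by positivity)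
      have e1 : eigenval L k ^ (2 * (1 / 2) : ℝ) = eigenval L k := by norm_num
      rw [e1, eigenval_eq, ← mul_assoc]
      exact mul_le_mul_of_nonneg_left (hle k) (mul_nonneg (by positivity) (hq0 k))
    have hY : ∑ k ∈ S.erase 0, freqSq k ^ 2 * ‖fourierCoef L w k j‖ ^ 2
        ≤ P ^ 2 / (L ^ 3 * κ ^ 4) := by
      rw [le_div_iff₀ (by positivity)]
      refine le_trans ?_ (sum_eigenval_mul_le_normA_sq hL hw.2 (S.erase 0))
      rw [mul_comm, mul_assoc, Finset.mul_sum]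
      refine mul_le_mul_of_nonneg_left (Finset.sum_le_sum fun k _ => ?_) (by positivity)
      have e2 : eigenval L k ^ (2 * 1 : ℝ) = eigenval L k ^ 2 := by
        rw [mul_one]; exact_mod_cast Real.rpow_natCast _ 2
      rw [e2, eigenval_eq, ← mul_assoc, mul_pow, ← pow_mul]
      exact mul_le_mul_of_nonneg_left (hle k) (by positivity)
    have := sum_sq_le_of_weighted_sums (S.erase 0) (Finset.notMem_erase 0 S) hX hY
    rw [hSz]
    refine this.trans (mul_le_mul_of_nonneg_left ?_ (by norm_num))
    rw [← Real.sqrt_mul (by positivity)]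
    refine Real.sqrt_le_iff.mpr ⟨by positivity, ?_⟩
    have e : N ^ 2 / (L ^ 3 * κ ^ 2) * (P ^ 2 / (L ^ 3 * κ ^ 4))
        = (N * P) ^ 2 / (L * κ) ^ 6 := by field_simp
    rw [e]
    exact div_le_self (by positivity) (one_le_pow₀ hκL)
  have hNP : 0 ≤ 104 * (N * P) := by positivity
  have key' : ∀ (j : Fin 3) (S : Finset (Fin 3 → ℤ)),
      ∑ k ∈ S, ‖fourierCoef L w k j‖ ≤ √(104 * (N * P)) := fun j S =>
    Real.le_sqrt_of_sq_le (key j S)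
  have hsum : ∀ j, Summable fun k => ‖fourierCoef L w k j‖ := fun j =>
    summable_of_sum_le (fun _ => norm_nonneg _) (key' j)
  have hae : ∀ᵐ x ∂(volume.restrict (box L)), ∀ j, |w x j| ≤ √(104 * (N * P)) := by
    rw [ae_all_iff]
    intro j
    filter_upwards [ae_abs_coord_le_tsum hL hw.1.memLp j (hsum j)] with x hx
    exact hx.trans (Real.tsum_le_of_sum_le (fun _ => norm_nonneg _) (key' j))
  filter_upwards [hae] with x hx
  rw [← Real.sqrt_eq_rpow, ← Real.sqrt_eq_rpow, mul_assoc, ← Real.sqrt_mul hN0]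
  rw [EuclideanSpace.norm_eq]
  refine Real.sqrt_le_iff.mpr ⟨by positivity, ?_⟩
  rw [mul_pow, Real.sq_sqrt (by positivity)]
  have : ∀ j, ‖w x j‖ ^ 2 ≤ 104 * (N * P) := fun j => by
    rw [← Real.sq_sqrt hNP]
    exact pow_le_pow_left₀ (norm_nonneg _) (hx j) 2
  calc ∑ j, ‖w x j‖ ^ 2 ≤ ∑ _j : Fin 3, 104 * (N * P) := Finset.sum_le_sum fun j _ => this j
    _ = 312 * (N * P) := by simp; ring
    -- Three components with `104` each: `312 ≤ 324 = 18²`.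
    _ ≤ 18 ^ 2 * (N * P) := by nlinarith [mul_nonneg hN0 hP0]

end Agmon

/-! ### Real trigonometric vector fields as test fields -/

section TrigFields

open ComplexConjugate

/-- The symbol `2πi k·e/L` of the derivative in direction `e`. -/
def derivSymbol (L : ℝ) (e : E3) (k : Fin 3 → ℤ) : ℂ :=
  (2 * (Real.pi : ℂ) * Complex.I / (L : ℂ)) * ∑ i, (k i : ℂ) * ((e i : ℝ) : ℂ)

/-- `derivSymbol` as a continuous linear map in the direction. -/
def derivSymbolCLM (L : ℝ) (k : Fin 3 → ℤ) : E3 →L[ℝ] ℂ :=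
  (2 * (Real.pi : ℂ) * Complex.I / (L : ℂ)) •
    ∑ i, (k i : ℂ) • (Complex.ofRealCLM.comp (EuclideanSpace.proj (𝕜 := ℝ) i))

lemma derivSymbolCLM_apply (L : ℝ) (k : Fin 3 → ℤ) (e : E3) :
    derivSymbolCLM L k e = derivSymbol L e k := by
  simp [derivSymbolCLM, derivSymbol]

lemma expMode_eq (L : ℝ) (k : Fin 3 → ℤ) :
    expMode L k = fun x => Complex.exp (derivSymbolCLM L k x) := by
  ext x; rw [derivSymbolCLM_apply]; rfl

lemma contDiff_expMode (L : ℝ) (k : Fin 3 → ℤ) : ContDiff ℝ ∞ (expMode L k) := by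
  rw [expMode_eq]
  exact (derivSymbolCLM L k).contDiff.cexp

lemma hasFDerivAt_expMode (L : ℝ) (k : Fin 3 → ℤ) (x : E3) :
    HasFDerivAt (expMode L k) (expMode L k x • derivSymbolCLM L k) x := by
  have h := ((derivSymbolCLM L k).hasFDerivAt (x := x)).cexp
  simpa only [expMode_eq] using h

lemma expMode_periodic {L : ℝ} (hL : 0 < L) (k : Fin 3 → ℤ) : IsPeriodic L (expMode L k) := by
  intro x i
  have h : derivSymbolCLM L k (EuclideanSpace.single i L) = k i * (2 * Real.pi * Complex.I) := by
    have hL' : (L : ℂ) ≠ 0 := by exact_mod_cast hL.ne'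
    rw [derivSymbolCLM_apply, derivSymbol, Finset.sum_eq_single i]
    · simp; field_simp
    · intro b _ hb; simp [hb]
    · simp
  simp only [expMode_eq, map_add, Complex.exp_add, h, Complex.exp_int_mul_two_pi_mul_I, mul_one]

/-- The real vector field with (finitely many) Fourier coefficients `c k`, `k ∈ S`. -/
def trigField (L : ℝ) (S : Finset (Fin 3 → ℤ)) (c : (Fin 3 → ℤ) → Fin 3 → ℂ) (x : E3) : E3 :=
  WithLp.toLp 2 fun j => (∑ k ∈ S, c k j * expMode L k x).re

lemma trigField_apply (L : ℝ) (S : Finset (Fin 3 → ℤ)) (c : (Fin 3 → ℤ) → Fin 3 → ℂ) (x : E3)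
    (j : Fin 3) : trigField L S c x j = (∑ k ∈ S, c k j * expMode L k x).re := rfl

lemma contDiff_trigField (L : ℝ) (S : Finset (Fin 3 → ℤ)) (c : (Fin 3 → ℤ) → Fin 3 → ℂ) :
    ContDiff ℝ ∞ (trigField L S c) := by
  rw [contDiff_euclidean]
  intro j
  exact Complex.reCLM.contDiff.comp
    (ContDiff.sum fun k _ => contDiff_const.mul (contDiff_expMode L k))

lemma trigField_periodic {L : ℝ} (hL : 0 < L) (S : Finset (Fin 3 → ℤ))
    (c : (Fin 3 → ℤ) → Fin 3 → ℂ) : IsPeriodic L (trigField L S c) := by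
  intro x i
  simp only [trigField, expMode_periodic hL _ x i]

/-- Differentiation is a Fourier multiplier, so a directional derivative is again a trigonometric
field and all estimates for such fields apply to it. -/
lemma fderiv_trigField (L : ℝ) (S : Finset (Fin 3 → ℤ)) (c : (Fin 3 → ℤ) → Fin 3 → ℂ)
    (x e : E3) : fderiv ℝ (trigField L S c) x e
      = trigField L S (fun k j => derivSymbol L e k * c k j) x := by
  have hd : DifferentiableAt ℝ (trigField L S c) x :=
    ((contDiff_trigField L S c).differentiable (by simp)).differentiableAt
  ext j
  have h1 := ((EuclideanSpace.proj (𝕜 := ℝ) j).hasFDerivAt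
    (x := trigField L S c x)).comp x hd.hasFDerivAt
  have h2 : HasFDerivAt (fun x => ∑ k ∈ S, c k j * expMode L k x)
      (∑ k ∈ S, c k j • (expMode L k x • derivSymbolCLM L k)) x :=
    HasFDerivAt.fun_sum fun k _ => (hasFDerivAt_expMode L k x).const_mul (c k j)
  have h3 := (Complex.reCLM.hasFDerivAt).comp x h2
  have h4 := congrArg (fun T : E3 →L[ℝ] ℝ => T e) (h1.unique h3)
  simp only [ContinuousLinearMap.comp_apply, sum_apply,
    smul_apply, derivSymbolCLM_apply,
    Complex.reCLM_apply, smul_eq_mul] at h4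
  refine h4.trans ?_
  rw [trigField_apply]
  congr 1
  exact Finset.sum_congr rfl fun k _ => by ring

lemma memLp_of_continuous {w : E3 → E3} (hw : Continuous w) (L : ℝ) :
    MemLp w 2 (volume.restrict (box L)) := by
  obtain ⟨C, hC⟩ := (isCompact_box L).exists_bound_of_continuousOn hw.continuousOn
  exact MemLp.of_bound hw.aestronglyMeasurable C
    ((ae_restrict_iff' (measurableSet_box L)).mpr (Filter.Eventually.of_forall hC))

lemma memLp_trigField (L : ℝ) (S : Finset (Fin 3 → ℤ)) (c : (Fin 3 → ℤ) → Fin 3 → ℂ) :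
    MemLp (trigField L S c) 2 (volume.restrict (box L)) :=
  memLp_of_continuous (contDiff_trigField L S c).continuous L

/-- Finite families of coefficients of real fields. -/
structure IsRealCoef (S : Finset (Fin 3 → ℤ)) (c : (Fin 3 → ℤ) → Fin 3 → ℂ) : Prop where
  neg_mem : ∀ k ∈ S, -k ∈ S
  conj_eq : ∀ k j, c (-k) j = conj (c k j)

/-- The substitution `k ↦ -k` shows the complex sum to be its own conjugate, so taking the real part
loses nothing and the coefficients can be read off. -/
lemma IsRealCoef.ofReal_trigField {S : Finset (Fin 3 → ℤ)} {c : (Fin 3 → ℤ) → Fin 3 → ℂ}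
    (h : IsRealCoef S c) (L : ℝ) (x : E3) (j : Fin 3) :
    ((trigField L S c x j : ℝ) : ℂ) = ∑ k ∈ S, c k j * expMode L k x := by
  rw [trigField_apply, ← Complex.conj_eq_iff_re, map_sum]
  refine Finset.sum_nbij' (fun k => -k) (fun k => -k) h.neg_mem h.neg_mem (by simp) (by simp) ?_
  intro k _
  rw [map_mul, h.conj_eq, expMode_neg]

lemma IsRealCoef.fourierCoef_trigField {S : Finset (Fin 3 → ℤ)} {c : (Fin 3 → ℤ) → Fin 3 → ℂ}
    (h : IsRealCoef S c) {L : ℝ} (hL : 0 < L) (m : Fin 3 → ℤ) (j : Fin 3) :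
    fourierCoef L (trigField L S c) m j = if m ∈ S then c m j else 0 := by
  rw [fourierCoef_eq_expMode]
  simp_rw [h.ofReal_trigField, Finset.sum_mul]
  rw [integral_finsetSum _ fun k _ => ?_, Finset.mul_sum]
  · have : ∀ k ∈ S, ((L : ℂ) ^ 3)⁻¹ * ∫ x in box L, c k j * expMode L k x * expMode L (-m) x
        = if k = m then c k j else 0 := fun k _ => by
      simp_rw [mul_assoc]
      rw [integral_const_mul, mul_left_comm, integral_expMode_mul_expMode_neg hL]
      split_ifs <;> simp
    rw [Finset.sum_congr rfl this, Finset.sum_ite_eq' S m]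
  · exact (((continuous_const.mul (continuous_expMode L k)).mul
      (continuous_expMode L _)).continuousOn.integrableOn_compact (isCompact_box L))

/-- The divergence of a `C¹` periodic field has zero integral over the box. -/
lemma integral_divergence_eq_zero {L : ℝ} (hL : 0 < L) {F : E3 → E3} (hF : ContDiff ℝ 1 F)
    (hper : IsPeriodic L F) :
    ∫ x in box L, ∑ i, fderiv ℝ F x (EuclideanSpace.single i 1) i = 0 := by
  have hd : Differentiable ℝ F := hF.differentiable one_ne_zero
  have hcont : Continuous fun x : E3 => ∑ i, fderiv ℝ F x (EuclideanSpace.single i 1) i := by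
    have := hF.continuous_fderiv one_ne_zero
    fun_prop
  let eL := (EuclideanSpace.equiv (Fin 3) ℝ).symm
  have hmp : MeasurePreserving eL (volume.restrict (Icc (fun _ => (0 : ℝ)) (fun _ => L)))
      (volume.restrict (box L)) := by
    have := (PiLp.volume_preserving_toLp (Fin 3)).restrict_preimage (measurableSet_box L)
    rw [box_eq_preimage] at this ⊢
    exact this
  rw [← hmp.integral_comp eL.toHomeomorph.measurableEmbedding]
  have key := integral_divergence_of_hasFDerivAt_off_countable' (n := 2) (E := ℝ)
    (fun _ => (0 : ℝ)) (fun _ => L) (fun _ => hL.le) (fun i y => F (eL y) i)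
    (fun i y => (EuclideanSpace.proj (𝕜 := ℝ) i).comp
      ((fderiv ℝ F (eL y)).comp (eL : (Fin 3 → ℝ) →L[ℝ] E3))) ∅ countable_empty
    (fun i => ((PiLp.continuous_apply 2 (fun _ : Fin 3 => ℝ) i).comp
      (hF.continuous.comp eL.continuous)).continuousOn)
    (fun y _ i => ((EuclideanSpace.proj (𝕜 := ℝ) i).hasFDerivAt).comp y
      ((hd _).hasFDerivAt.comp y eL.hasFDerivAt))
    ((hcont.comp eL.continuous).continuousOn.integrableOn_compact isCompact_Icc)
  refine Eq.trans ?_ (key.trans ?_)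
  · rfl
  · refine Finset.sum_eq_zero fun i _ => ?_
    rw [sub_eq_zero]
    refine integral_congr_ae (Filter.Eventually.of_forall fun z => ?_)
    -- Opposite faces differ by a translation by one period, so their fluxes cancel.
    have : eL (i.insertNth L z) = eL (i.insertNth 0 z) + EuclideanSpace.single i L := by
      ext l
      change (i.insertNth L z : Fin 3 → ℝ) l
        = (i.insertNth 0 z : Fin 3 → ℝ) l + (EuclideanSpace.single i L : E3) l
      rcases eq_or_ne l i with rfl | hl
      · simp
      · obtain ⟨l, rfl⟩ := Fin.exists_succAbove_eq hl
        simp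
    simp only [this, hper _ i]

/-- Pointwise divergence-free periodic fields are weakly divergence-free. -/
lemma integral_fderiv_apply_eq_zero {L : ℝ} (hL : 0 < L) {P : E3 → E3} (hP : ContDiff ℝ 1 P)
    (hper : IsPeriodic L P)
    (hdiv : ∀ x, ∑ i, fderiv ℝ P x (EuclideanSpace.single i 1) i = 0)
    {φ : E3 → ℝ} (hφ : ContDiff ℝ 1 φ) (hφp : IsPeriodic L φ) :
    ∫ x in box L, fderiv ℝ φ x (P x) = 0 := by
  -- Since `P` is divergence-free, `div (φP) = ∇φ · P`.
  rw [← integral_divergence_eq_zero hL (hφ.smul hP)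
    (fun x i => by simp only [Pi.smul_apply', hper x i, hφp x i])]
  refine integral_congr_ae (Filter.Eventually.of_forall fun x => ?_)
  have h1 : HasFDerivAt φ (fderiv ℝ φ x) x :=
    (hφ.differentiable one_ne_zero).differentiableAt.hasFDerivAt
  have h2 : HasFDerivAt P (fderiv ℝ P x) x :=
    (hP.differentiable one_ne_zero).differentiableAt.hasFDerivAt
  have h3 := (h1.smul h2).fderiv
  simp only
  rw [h3]
  simp only [add_apply, smul_apply,
    ContinuousLinearMap.smulRight_apply, PiLp.add_apply, PiLp.smul_apply, smul_eq_mul,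
    Finset.sum_add_distrib, ← Finset.mul_sum, hdiv, mul_zero, zero_add]
  have hx : P x = ∑ i, P x i • EuclideanSpace.single i (1 : ℝ) := by
    ext l; simp [Pi.single_apply]
  conv_lhs => rw [hx, map_sum]
  simp [mul_comm]

lemma integral_trigField_eq_zero {S : Finset (Fin 3 → ℤ)} {c : (Fin 3 → ℤ) → Fin 3 → ℂ}
    (h : IsRealCoef S c) {L : ℝ} (hL : 0 < L) (h0 : ∀ j, c 0 j = 0) :
    ∫ x in box L, trigField L S c x = 0 := by
  have hi : Integrable (trigField L S c) (volume.restrict (box L)) :=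
    (memLp_trigField L S c).integrable (by norm_num)
  ext j
  have h1 := (EuclideanSpace.proj (𝕜 := ℝ) j).integral_comp_comm hi
  have h2 : fourierCoef L (trigField L S c) 0 j = 0 := by
    rw [h.fourierCoef_trigField hL, h0]; simp
  have hL' : (L : ℂ) ≠ 0 := by exact_mod_cast hL.ne'
  simp only [fourierCoef, Pi.zero_apply, Int.cast_zero, zero_mul, Finset.sum_const_zero, mul_zero,
    Complex.exp_zero, mul_one, integral_complex_ofReal, mul_eq_zero, inv_eq_zero, pow_eq_zero_iff,
    ne_eq, OfNat.ofNat_ne_zero, not_false_eq_true, hL', false_or, Complex.ofReal_eq_zero] at h2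
  simpa [h2] using h1.symm

lemma IsRealCoef.memH_trigField {S : Finset (Fin 3 → ℤ)} {c : (Fin 3 → ℤ) → Fin 3 → ℂ}
    (h : IsRealCoef S c) {L : ℝ} (hL : 0 < L) (h0 : ∀ j, c 0 j = 0)
    (hdiv : ∀ k ∈ S, ∑ j, (k j : ℂ) * c k j = 0) : MemH L (trigField L S c) where
  periodic := trigField_periodic hL S c
  memLp := memLp_trigField L S c
  meanZero := integral_trigField_eq_zero h hL h0
  divFree φ hφ hφp := by
    refine integral_fderiv_apply_eq_zero hL ((contDiff_trigField L S c).of_le (by simp))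
      (trigField_periodic hL S c) (fun x => ?_) (hφ.of_le (by simp)) hφp
    simp only [fderiv_trigField, trigField_apply, ← Complex.re_sum]
    rw [Finset.sum_comm]
    have : ∀ k ∈ S, ∑ i, derivSymbol L (EuclideanSpace.single i 1) k * c k i * expMode L k x
        = 0 := fun k hk => by
      have e : ∀ i, derivSymbol L (EuclideanSpace.single i 1) k
          = (2 * (Real.pi : ℂ) * Complex.I / (L : ℂ)) * k i := fun i => by
        rw [derivSymbol, Finset.sum_eq_single i]
        · simp
        · intro b _ hb; simp [hb]
        · simp
      rw [← Finset.sum_mul]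
      simp only [e, mul_assoc, ← Finset.mul_sum]
      simp [hdiv k hk]
    rw [Finset.sum_eq_zero this, Complex.zero_re]

lemma fourierCoef_neg (L : ℝ) (w : E3 → E3) (k : Fin 3 → ℤ) (j : Fin 3) :
    fourierCoef L w (-k) j = conj (fourierCoef L w k j) := by
  simp only [fourierCoef_eq_expMode, map_mul, map_inv₀, map_pow, Complex.conj_ofReal,
    ← integral_conj, expMode_neg, Complex.conj_conj]

/-- The Fourier coefficients of a weakly divergence-free field are orthogonal to the frequency. -/
lemma MemH.sum_freq_mul_fourierCoef {L : ℝ} (hL : 0 < L) {w : E3 → E3} (hw : MemH L w)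
    (k : Fin 3 → ℤ) : ∑ j, (k j : ℂ) * fourierCoef L w k j = 0 := by
  have hterm : ∀ j, Integrable (fun x => ((w x j : ℝ) : ℂ) * expMode L (-k) x)
      (volume.restrict (box L)) := fun j =>
    ((memLp_coord hw.memLp j).integrable (by norm_num)).mul_bdd (c := 1)
      (continuous_expMode L (-k)).aestronglyMeasurable
      (Filter.Eventually.of_forall fun x => (norm_expMode L (-k) x).le)
  set G : E3 → ℂ := fun x => expMode L (-k) x * derivSymbol L (w x) (-k) with hG
  have hGsum : G = fun x => -(2 * (Real.pi : ℂ) * Complex.I / (L : ℂ)) *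
      ∑ j, (k j : ℂ) * (((w x j : ℝ) : ℂ) * expMode L (-k) x) := by
    ext x
    simp only [hG, derivSymbol, Finset.mul_sum, Pi.neg_apply, Int.cast_neg]
    exact Finset.sum_congr rfl fun j _ => by ring
  have hGi : Integrable G (volume.restrict (box L)) := by
    rw [hGsum]
    exact (integrable_finsetSum _ fun j _ => (hterm j).const_mul _).const_mul _
  -- `divFree` takes real test functions, so the real and imaginary parts of the exponential are
  -- tested separately.
  have hzero : ∀ (R : ℂ →L[ℝ] ℝ), R (∫ x in box L, G x) = 0 := fun R => by
    rw [← R.integral_comp_comm hGi]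
    have h := hw.divFree (fun x => R (expMode L (-k) x)) (R.contDiff.comp (contDiff_expMode L _))
      (fun x i => by simp only [expMode_periodic hL _ x i])
    rw [← h]
    refine integral_congr_ae (Filter.Eventually.of_forall fun x => ?_)
    have h2 := (R.hasFDerivAt.comp x (hasFDerivAt_expMode L (-k) x)).fderiv
    change _ = fderiv ℝ (R ∘ expMode L (-k)) x (w x)
    rw [h2]
    simp [derivSymbolCLM_apply, hG]
  have hG0 : ∫ x in box L, G x = 0 :=
    Complex.ext (hzero Complex.reCLM) (hzero Complex.imCLM)
  rw [hGsum, integral_const_mul, integral_finsetSum _ fun j _ => (hterm j).const_mul _] at hG0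
  have hne : -(2 * (Real.pi : ℂ) * Complex.I / (L : ℂ)) ≠ 0 := by
    have hL' : (L : ℂ) ≠ 0 := by exact_mod_cast hL.ne'
    have : (Real.pi : ℂ) ≠ 0 := by exact_mod_cast Real.pi_ne_zero
    simp [hL', this]
  have h3 := (mul_eq_zero.mp hG0).resolve_left hne
  simp only [integral_const_mul] at h3
  simp only [fourierCoef_eq_expMode, mul_left_comm _ (((L : ℂ) ^ 3)⁻¹), ← Finset.mul_sum, h3,
    mul_zero]

end TrigFields

/-! ### Enlarging the class of time test functions by mollification -/

section TimeCutoffs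

open Filter Topology
open scoped Convolution

/-- A bump of width tending to zero. -/
def mollifier (n : ℕ) : ContDiffBump (0 : ℝ) where
  rIn := 1 / (4 * ((n : ℝ) + 1))
  rOut := 1 / (2 * ((n : ℝ) + 1))
  rIn_pos := by positivity
  rIn_lt_rOut := by
    have : (0 : ℝ) ≤ n := Nat.cast_nonneg n
    rw [div_lt_div_iff₀ (by positivity) (by positivity)]
    linarith

lemma mollifier_rOut (n : ℕ) : (mollifier n).rOut = 1 / (2 * ((n : ℝ) + 1)) := rfl

/-- The mollification of `G`, delayed so that its support moves into `(0, ∞)`. -/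
def delayedMollify (G : ℝ → ℝ) (n : ℕ) (t : ℝ) : ℝ :=
  ((mollifier n).normed volume ⋆[ContinuousLinearMap.lsmul ℝ ℝ, volume] G) (t - 1 / ((n : ℝ) + 1))

lemma tendsto_mollifier_rOut : Tendsto (fun n => (mollifier n).rOut) atTop (𝓝 0) := by
  have h := (tendsto_one_div_add_atTop_nhds_zero_nat (𝕜 := ℝ)).const_mul (1 / 2)
  rw [mul_zero] at h
  refine h.congr fun n => ?_
  rw [mollifier_rOut]; field_simp

lemma tendsto_delayedMollify {G : ℝ → ℝ} (hG : Continuous G) (t : ℝ) :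
    Tendsto (fun n => delayedMollify G n t) atTop (𝓝 (G t)) := by
  refine ContDiffBump.convolution_tendsto_right (g := fun _ => G) tendsto_mollifier_rOut
    (Eventually.of_forall fun _ => hG.aestronglyMeasurable) ((hG.tendsto t).comp tendsto_snd) ?_
  simpa using (tendsto_const_nhds (x := t)).sub (tendsto_one_div_add_atTop_nhds_zero_nat (𝕜 := ℝ))

/-- Only a bound uniform in `n` is needed, as a majorant for dominated convergence; `3 * B` is `2 *
B` for the distance to `G` plus `B` for `G` itself. -/
lemma abs_delayedMollify_le {G : ℝ → ℝ} (hG : Continuous G) {B : ℝ} (hB : ∀ t, |G t| ≤ B) (n : ℕ)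
    (t : ℝ) : |delayedMollify G n t| ≤ 3 * B := by
  have h := (mollifier n).dist_normed_convolution_le (μ := volume)
    (x₀ := t - 1 / ((n : ℝ) + 1)) (ε := 2 * B) hG.aestronglyMeasurable (g := G) (fun x _ => by
      rw [Real.dist_eq]
      exact (abs_sub _ _).trans (by linarith [hB x, hB (t - 1 / ((n : ℝ) + 1))]))
  rw [Real.dist_eq] at h
  have h2 := abs_sub_abs_le_abs_sub (delayedMollify G n t) (G (t - 1 / ((n : ℝ) + 1)))
  have h3 := hB (t - 1 / ((n : ℝ) + 1))
  have h4 : |delayedMollify G n t - G (t - 1 / ((n : ℝ) + 1))| ≤ 2 * B := h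
  linarith

/-- The delay `1/(n+1)` is twice the radius of the bump, so the support starts no earlier than half
the delay, strictly inside `(0, ∞)`. -/
lemma delayedMollify_eq_zero {G : ℝ → ℝ} {T : ℝ} (hG : Function.support G ⊆ Icc 0 T) (n : ℕ)
    {t : ℝ} (ht : t ∉ Icc (1 / (2 * ((n : ℝ) + 1))) (T + 2)) : delayedMollify G n t = 0 := by
  by_contra hne
  have hmem : t - 1 / ((n : ℝ) + 1) ∈ Function.support
      ((mollifier n).normed volume ⋆[ContinuousLinearMap.lsmul ℝ ℝ, volume] G) := hne
  obtain ⟨s, hs, r, hr, hsr⟩ := support_convolution_subset_swap _ hmem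
  have hs' := hG hs
  rw [ContDiffBump.support_normed_eq, mem_ball_zero_iff, Real.norm_eq_abs, abs_lt,
    mollifier_rOut] at hr
  have ha : 1 / (2 * ((n : ℝ) + 1)) = 1 / ((n : ℝ) + 1) / 2 := by field_simp
  have ha1 : 1 / ((n : ℝ) + 1) ≤ 1 := by
    rw [div_le_one (by positivity)]; linarith [Nat.cast_nonneg (α := ℝ) n]
  rw [ha] at hr ht
  simp only at hsr
  exact ht ⟨by linarith [hs'.1, hr.1], by linarith [hs'.2, hr.2]⟩

lemma tendsto_integral_delayedMollify {G h : ℝ → ℝ} (hG : Continuous G) {B T M : ℝ}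
    (hB : ∀ t, |G t| ≤ B) (hsupp : Function.support G ⊆ Icc 0 T)
    (hh : AEStronglyMeasurable h (volume.restrict (Ioi 0)))
    (hM : ∀ᵐ t ∂(volume.restrict (Ioi (0 : ℝ))), |h t| ≤ M) :
    Tendsto (fun n => ∫ t in Ioi (0 : ℝ), delayedMollify G n t * h t) atTop
      (𝓝 (∫ t in Ioi (0 : ℝ), G t * h t)) := by
  have hB0 : 0 ≤ B := (abs_nonneg _).trans (hB 0)
  refine tendsto_integral_of_dominated_convergence
    ((Icc 0 (T + 2)).indicator fun _ => 3 * B * M) (fun n => ?_) ?_ (fun n => ?_) ?_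
  · refine AEStronglyMeasurable.mul ?_ hh
    have : Continuous (delayedMollify G n) := by
      have h1 := ((mollifier n).hasCompactSupport_normed (μ := volume)).continuous_convolution_left
        (ContinuousLinearMap.lsmul ℝ ℝ) (mollifier n).continuous_normed
        (hG.locallyIntegrable (μ := volume))
      exact h1.comp (continuous_id.sub continuous_const)
    exact this.aestronglyMeasurable
  · exact (((integrable_indicator_iff measurableSet_Icc).mpr
      (continuous_const.integrableOn_Icc)).restrict)
  · filter_upwards [hM] with t ht
    by_cases htm : t ∈ Icc (0 : ℝ) (T + 2)
    · rw [indicator_of_mem htm, norm_mul]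
      exact mul_le_mul (abs_delayedMollify_le hG hB n t) ht (norm_nonneg _) (by positivity)
    · rw [indicator_of_notMem htm, delayedMollify_eq_zero hsupp n, zero_mul, norm_zero]
      exact fun h => htm ⟨le_trans (by positivity) h.1, h.2⟩
  · exact Eventually.of_forall fun t => (tendsto_delayedMollify hG t).mul_const _

/-- A weak derivative against test functions supported in `(0, ∞)` can be tested against `C¹`
functions with compact support in `[0, ∞)`. -/
lemma integral_deriv_mul_eq_of_forall_test {g h : ℝ → ℝ} {M N T : ℝ}
    (hg : AEStronglyMeasurable g (volume.restrict (Ioi 0)))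
    (hgM : ∀ᵐ t ∂(volume.restrict (Ioi (0 : ℝ))), |g t| ≤ M)
    (hh : AEStronglyMeasurable h (volume.restrict (Ioi 0)))
    (hhN : ∀ᵐ t ∂(volume.restrict (Ioi (0 : ℝ))), |h t| ≤ N)
    (hweak : ∀ φ : ℝ → ℝ, ContDiff ℝ ∞ φ → HasCompactSupport φ → tsupport φ ⊆ Ioi 0 →
      ∫ t in Ioi (0 : ℝ), deriv φ t * g t = ∫ t in Ioi (0 : ℝ), φ t * h t)
    {η : ℝ → ℝ} (hη : ContDiff ℝ 1 η) (hsupp : Function.support η ⊆ Icc 0 T) :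
    ∫ t in Ioi (0 : ℝ), deriv η t * g t = ∫ t in Ioi (0 : ℝ), η t * h t := by
  have hts : tsupport η ⊆ Icc 0 T := closure_minimal hsupp isClosed_Icc
  have hcs : HasCompactSupport η := isCompact_Icc.of_isClosed_subset isClosed_closure hts
  have hds : Function.support (deriv η) ⊆ Icc 0 T := (support_deriv_subset).trans hts
  have hdc : Continuous (deriv η) := hη.continuous_deriv le_rfl
  obtain ⟨B, hB⟩ := hη.continuous.bounded_above_of_compact_support hcs
  obtain ⟨B', hB'⟩ := hdc.bounded_above_of_compact_support hcs.deriv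
  have h1 := tendsto_integral_delayedMollify hη.continuous hB hsupp hh hhN
  have h2 := tendsto_integral_delayedMollify hdc hB' hds hg hgM
  -- Each delayed mollification of `η` is an admissible test function whose derivative is the
  -- delayed mollification of `deriv η`; both sides pass to the limit.
  refine tendsto_nhds_unique (h2.congr fun n => ?_) h1
  have hsm : ContDiff ℝ ∞ (delayedMollify η n) :=
    (((mollifier n).hasCompactSupport_normed (μ := volume)).contDiff_convolution_left
      (ContinuousLinearMap.lsmul ℝ ℝ) (mollifier n).contDiff_normed
      (hη.continuous.locallyIntegrable (μ := volume))).comp (contDiff_id.sub contDiff_const)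
  have hderiv : deriv (delayedMollify η n) = delayedMollify (deriv η) n := by
    ext t
    have h := hcs.hasDerivAt_convolution_right (ContinuousLinearMap.lsmul ℝ ℝ)
      (((mollifier n).continuous_normed (μ := volume)).locallyIntegrable (μ := volume)) hη
      (t - 1 / ((n : ℝ) + 1))
    exact (h.comp_sub_const t (1 / ((n : ℝ) + 1))).deriv
  have hts' : tsupport (delayedMollify η n) ⊆ Icc (1 / (2 * ((n : ℝ) + 1))) (T + 2) :=
    closure_minimal (fun t ht => by
      by_contra hc
      exact ht (delayedMollify_eq_zero hsupp n hc)) isClosed_Icc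
  have := hweak (delayedMollify η n) hsm
    (isCompact_Icc.of_isClosed_subset isClosed_closure hts')
    (hts'.trans fun t ht => lt_of_lt_of_le (by positivity) ht.1)
  rw [hderiv] at this
  exact this

end TimeCutoffs

/-! ### Truncations of `A⁻¹ f` and their norms -/

section InverseStokes

open ComplexConjugate

lemma abs_innerL2_le {L : ℝ} {w v : E3 → E3} (hw : MemLp w 2 (volume.restrict (box L)))
    (hv : MemLp v 2 (volume.restrict (box L))) :
    |innerL2 L w v| ≤ normL2 L w * normL2 L v := by
  have hin : ∀ {a b : E3 → E3} (ha : MemLp a 2 (volume.restrict (box L)))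
      (hb : MemLp b 2 (volume.restrict (box L))),
      inner ℝ (ha.toLp a) (hb.toLp b) = innerL2 L a b := fun ha hb => by
    rw [L2.inner_def]
    refine integral_congr_ae ?_
    filter_upwards [ha.coeFn_toLp, hb.coeFn_toLp] with x h1 h2
    rw [h1, h2]
  have hn : ∀ {a : E3 → E3} (ha : MemLp a 2 (volume.restrict (box L))),
      ‖ha.toLp a‖ = normL2 L a := fun {a} ha => by
    rw [← sq_eq_sq₀ (norm_nonneg _) (normL2_nonneg _ _), normL2_sq, ← hin ha ha,
      real_inner_self_eq_norm_sq]
  rw [← hin hw hv, ← hn hw, ← hn hv]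
  exact abs_real_inner_le_norm _ _

lemma eigenval_neg (L : ℝ) (k : Fin 3 → ℤ) : eigenval L (-k) = eigenval L k := by
  simp [eigenval]

lemma rpow_two_mul_half (x : ℝ) : x ^ (2 * (1 / 2) : ℝ) = x := by norm_num

lemma rpow_two_mul_one (x : ℝ) : x ^ (2 * 1 : ℝ) = x ^ 2 := by
  rw [mul_one]; exact_mod_cast Real.rpow_natCast x 2

lemma rpow_two_mul_neg_one {x : ℝ} (hx : 0 ≤ x) : x ^ (2 * (-1) : ℝ) = (x⁻¹) ^ 2 := by
  rw [mul_neg, mul_one, Real.rpow_neg hx, inv_pow]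
  congr 1
  exact_mod_cast Real.rpow_natCast x 2

lemma rpow_two_mul_neg_half (x : ℝ) : x ^ (2 * (-1 / 2) : ℝ) = x⁻¹ := by
  rw [← Real.rpow_neg_one]; norm_num

/-- Coefficients of `A⁻¹ f`. -/
def invStokesCoef (L : ℝ) (f : E3 → E3) (k : Fin 3 → ℤ) (j : Fin 3) : ℂ :=
  (((eigenval L k)⁻¹ : ℝ) : ℂ) * fourierCoef L f k j

section

variable {L : ℝ} {f : E3 → E3} {S : Finset (Fin 3 → ℤ)}

lemma isRealCoef_fourierCoef (hS : ∀ k ∈ S, -k ∈ S) (L : ℝ) (f : E3 → E3) :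
    IsRealCoef S (fourierCoef L f) := ⟨hS, fourierCoef_neg L f⟩

lemma isRealCoef_invStokesCoef (hS : ∀ k ∈ S, -k ∈ S) (L : ℝ) (f : E3 → E3) :
    IsRealCoef S (invStokesCoef L f) := ⟨hS, fun k j => by
  simp only [invStokesCoef, eigenval_neg, fourierCoef_neg, map_mul, Complex.conj_ofReal]⟩

lemma derivSymbol_neg (L : ℝ) (e : E3) (k : Fin 3 → ℤ) :
    derivSymbol L e (-k) = conj (derivSymbol L e k) := by
  simp [derivSymbol, Complex.conj_ofReal, Complex.conj_ofNat]
  ring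

lemma isRealCoef_derivSymbol_mul {c : (Fin 3 → ℤ) → Fin 3 → ℂ} (hc : IsRealCoef S c) (L : ℝ)
    (e : E3) : IsRealCoef S fun k j => derivSymbol L e k * c k j :=
  ⟨hc.neg_mem, fun k j => by simp only [derivSymbol_neg, hc.conj_eq, map_mul]⟩

lemma norm_derivSymbol_sq_le (L : ℝ) (e : E3) (k : Fin 3 → ℤ) :
    ‖derivSymbol L e k‖ ^ 2 ≤ eigenval L k * ‖e‖ ^ 2 := by
  have h : derivSymbol L e k
      = ((2 * Real.pi / L * ∑ i, (k i : ℝ) * e i : ℝ) : ℂ) * Complex.I := by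
    unfold derivSymbol; push_cast; ring
  rw [h, norm_mul, Complex.norm_I, mul_one, Complex.norm_real, Real.norm_eq_abs, sq_abs, mul_pow,
    eigenval, mul_assoc, EuclideanSpace.norm_sq_eq]
  refine mul_le_mul_of_nonneg_left ?_ (sq_nonneg _)
  simpa using Finset.sum_mul_sq_le_sq_mul_sq Finset.univ (fun i => (k i : ℝ)) (fun i => e i)

lemma sum_norm_invStokesCoef_sq (L : ℝ) (f : E3 → E3) (k : Fin 3 → ℤ) :
    ∑ j, ‖invStokesCoef L f k j‖ ^ 2
      = ((eigenval L k)⁻¹) ^ 2 * ∑ j, ‖fourierCoef L f k j‖ ^ 2 := by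
  rw [Finset.mul_sum]
  refine Finset.sum_congr rfl fun j _ => ?_
  rw [invStokesCoef, norm_mul, mul_pow, Complex.norm_real, Real.norm_eq_abs, sq_abs]

lemma IsRealCoef.hasSum_normA {c : (Fin 3 → ℤ) → Fin 3 → ℂ} (hc : IsRealCoef S c) (hL : 0 < L)
    (s : ℝ) :
    HasSum (fun k => eigenval L k ^ (2 * s) * ∑ j, ‖fourierCoef L (trigField L S c) k j‖ ^ 2)
      (∑ k ∈ S, eigenval L k ^ (2 * s) * ∑ j, ‖c k j‖ ^ 2) := by
  have h : ∀ k, (eigenval L k ^ (2 * s) * ∑ j, ‖fourierCoef L (trigField L S c) k j‖ ^ 2)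
      = if k ∈ S then eigenval L k ^ (2 * s) * ∑ j, ‖c k j‖ ^ 2 else 0 := fun k => by
    simp only [hc.fourierCoef_trigField hL]
    split_ifs <;> simp
  have h2 := hasSum_sum_of_ne_finset_zero (L := .unconditional _) (s := S)
    (f := fun k => eigenval L k ^ (2 * s) * ∑ j, ‖fourierCoef L (trigField L S c) k j‖ ^ 2)
    (fun k hk => by rw [h, if_neg hk])
  rwa [Finset.sum_congr rfl fun k hk => (h k).trans (if_pos hk)] at h2

lemma IsRealCoef.normA_trigField_sq {c : (Fin 3 → ℤ) → Fin 3 → ℂ} (hc : IsRealCoef S c)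
    (hL : 0 < L) (s : ℝ) :
    normA L s (trigField L S c) ^ 2
      = L ^ 3 * ∑ k ∈ S, eigenval L k ^ (2 * s) * ∑ j, ‖c k j‖ ^ 2 := by
  rw [normA_sq hL, (hc.hasSum_normA hL s).tsum_eq]

lemma IsRealCoef.normL2_trigField_sq {c : (Fin 3 → ℤ) → Fin 3 → ℂ} (hc : IsRealCoef S c)
    (hL : 0 < L) :
    normL2 L (trigField L S c) ^ 2 = L ^ 3 * ∑ k ∈ S, ∑ j, ‖c k j‖ ^ 2 := by
  have h1 := hasSum_fourierCoef_sq hL (memLp_trigField L S c)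
  have h2 := hc.hasSum_normA hL 0
  simp only [mul_zero, Real.rpow_zero, one_mul] at h2
  rw [← h1.unique h2]
  field_simp

lemma IsRealCoef.innerL2_trigField {c : (Fin 3 → ℤ) → Fin 3 → ℂ} (hc : IsRealCoef S c)
    (hL : 0 < L) {w : E3 → E3} (hw : MemLp w 2 (volume.restrict (box L))) :
    innerL2 L w (trigField L S c)
      = L ^ 3 * ∑ k ∈ S, ∑ j, (fourierCoef L w k j * conj (c k j)).re := by
  have h1 := hasSum_fourierCoef_mul_conj hL hw (memLp_trigField L S c)
  have h : ∀ k, ∑ j, (fourierCoef L w k j * conj (fourierCoef L (trigField L S c) k j)).re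
      = if k ∈ S then ∑ j, (fourierCoef L w k j * conj (c k j)).re else 0 := fun k => by
    simp only [hc.fourierCoef_trigField hL]
    split_ifs <;> simp
  simp only [h] at h1
  have h2 := hasSum_sum_of_ne_finset_zero (L := .unconditional _) (s := S) (f := fun k =>
    if k ∈ S then ∑ j, (fourierCoef L w k j * conj (c k j)).re else 0)
    (fun k hk => if_neg hk)
  rw [Finset.sum_congr rfl fun k hk => if_pos hk] at h2
  rw [← h1.unique h2]
  field_simp

lemma IsRealCoef.innerA_trigField {c : (Fin 3 → ℤ) → Fin 3 → ℂ} (hc : IsRealCoef S c)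
    (hL : 0 < L) (s : ℝ) (w : E3 → E3) :
    innerA L s w (trigField L S c)
      = L ^ 3 * ∑ k ∈ S, eigenval L k ^ (2 * s) *
          ∑ j, (fourierCoef L w k j * conj (c k j)).re := by
  rw [innerA, tsum_eq_sum (s := S) fun k hk => by simp [hc.fourierCoef_trigField hL, hk]]
  congr 1
  refine Finset.sum_congr rfl fun k hk => ?_
  simp [hc.fourierCoef_trigField hL, hk]

/-- `(A^{1/2} w, A^{1/2} A⁻¹ f_S) = (w, f_S)` for truncations `f_S` of `f`. -/
lemma innerA_half_invStokes (hL : 0 < L) (hf : MemH L f) (hS : ∀ k ∈ S, -k ∈ S)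
    {w : E3 → E3} (hw : MemLp w 2 (volume.restrict (box L))) :
    innerA L (1 / 2) w (trigField L S (invStokesCoef L f))
      = innerL2 L w (trigField L S (fourierCoef L f)) := by
  rw [(isRealCoef_invStokesCoef hS L f).innerA_trigField hL,
    (isRealCoef_fourierCoef hS L f).innerL2_trigField hL hw]
  congr 1
  refine Finset.sum_congr rfl fun k _ => ?_
  rw [rpow_two_mul_half, Finset.mul_sum]
  refine Finset.sum_congr rfl fun j _ => ?_
  -- On the zero mode `λ * λ⁻¹ = 1` fails, but both sides vanish because `f` has mean zero.
  rcases eq_or_ne k 0 with rfl | hk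
  · simp [fourierCoef_zero hf, eigenval_zero]
  · have hpos := eigenval_pos hL hk
    have : fourierCoef L w k j * conj (invStokesCoef L f k j)
        = (((eigenval L k)⁻¹ : ℝ) : ℂ) * (fourierCoef L w k j * conj (fourierCoef L f k j)) := by
      simp only [invStokesCoef, map_mul, Complex.conj_ofReal]; ring
    rw [this, Complex.re_ofReal_mul, mul_inv_cancel_left₀ hpos.ne']

/-- These are partial sums of `‖A^{-1/2} f‖²`, the main term of the balance. -/
lemma innerL2_invStokes (hL : 0 < L) (hf : MemLp f 2 (volume.restrict (box L)))
    (hS : ∀ k ∈ S, -k ∈ S) :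
    innerL2 L f (trigField L S (invStokesCoef L f))
      = L ^ 3 * ∑ k ∈ S, eigenval L k ^ (2 * (-1 / 2) : ℝ) * ∑ j, ‖fourierCoef L f k j‖ ^ 2 := by
  rw [(isRealCoef_invStokesCoef hS L f).innerL2_trigField hL hf]
  congr 1
  refine Finset.sum_congr rfl fun k _ => ?_
  rw [rpow_two_mul_neg_half, Finset.mul_sum]
  refine Finset.sum_congr rfl fun j _ => ?_
  have : fourierCoef L f k j * conj (invStokesCoef L f k j)
      = (((eigenval L k)⁻¹ : ℝ) : ℂ) * (fourierCoef L f k j * conj (fourierCoef L f k j)) := by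
    simp only [invStokesCoef, map_mul, Complex.conj_ofReal]; ring
  rw [this, Complex.re_ofReal_mul, Complex.mul_conj, Complex.ofReal_re, Complex.normSq_eq_norm_sq]

lemma sum_fourierCoef_sq_le (hL : 0 < L) (hf : MemLp f 2 (volume.restrict (box L)))
    (S : Finset (Fin 3 → ℤ)) :
    L ^ 3 * ∑ k ∈ S, ∑ j, ‖fourierCoef L f k j‖ ^ 2 ≤ normL2 L f ^ 2 := by
  have h := sum_le_hasSum S (fun k _ => Finset.sum_nonneg fun j _ => sq_nonneg _)
    (hasSum_fourierCoef_sq hL hf)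
  rwa [le_inv_mul_iff₀ (by positivity)] at h

lemma normL2_trunc_le (hL : 0 < L) (hf : MemLp f 2 (volume.restrict (box L)))
    (hS : ∀ k ∈ S, -k ∈ S) : normL2 L (trigField L S (fourierCoef L f)) ≤ normL2 L f := by
  rw [← sq_le_sq₀ (normL2_nonneg _ _) (normL2_nonneg _ _),
    (isRealCoef_fourierCoef hS L f).normL2_trigField_sq hL]
  exact sum_fourierCoef_sq_le hL hf S

/-- By the spectral gap, `A⁻¹` is bounded. Without summability the `tsum` in `normA` would take the
default value 0 and could not bound its partial sums. -/
lemma summable_normA_neg_one (hL : 0 < L) (hf : MemLp f 2 (volume.restrict (box L))) :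
    Summable fun k : Fin 3 → ℤ =>
      eigenval L k ^ (2 * (-1) : ℝ) * ∑ j, ‖fourierCoef L f k j‖ ^ 2 := by
  refine Summable.of_nonneg_of_le (fun k => ?_) (fun k => ?_)
    ((hasSum_fourierCoef_sq hL hf).summable.mul_left ((((2 * Real.pi / L) ^ 2)⁻¹) ^ 2))
  · have := eigenval_nonneg L k; positivity
  · refine mul_le_mul_of_nonneg_right ?_ (by positivity)
    rw [rpow_two_mul_neg_one (eigenval_nonneg L k)]
    rcases eq_or_ne k 0 with rfl | hk
    · rw [eigenval_zero]; simp; positivity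
    · have h1 := one_le_freqSq hk
      have : 0 < (2 * Real.pi / L) ^ 2 := by positivity
      have h2 : (2 * Real.pi / L) ^ 2 ≤ eigenval L k := by rw [eigenval_eq]; nlinarith
      have h3 : (eigenval L k)⁻¹ ≤ ((2 * Real.pi / L) ^ 2)⁻¹ := inv_anti₀ this h2
      exact pow_le_pow_left₀ (inv_nonneg.mpr (eigenval_nonneg L k)) h3 2

lemma normL2_invStokes_le (hL : 0 < L) (hf : MemLp f 2 (volume.restrict (box L)))
    (hS : ∀ k ∈ S, -k ∈ S) :
    normL2 L (trigField L S (invStokesCoef L f)) ≤ normA L (-1) f := by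
  rw [← sq_le_sq₀ (normL2_nonneg _ _) (normA_nonneg _ _ _),
    (isRealCoef_invStokesCoef hS L f).normL2_trigField_sq hL]
  refine le_trans (le_of_eq ?_) (sum_eigenval_mul_le_normA_sq hL (summable_normA_neg_one hL hf) S)
  congr 1
  refine Finset.sum_congr rfl fun k _ => ?_
  rw [rpow_two_mul_neg_one (eigenval_nonneg L k), sum_norm_invStokesCoef_sq]

lemma memH_invStokes (hL : 0 < L) (hf : MemH L f) (hS : ∀ k ∈ S, -k ∈ S) :
    MemH L (trigField L S (invStokesCoef L f)) := by
  refine (isRealCoef_invStokesCoef hS L f).memH_trigField hL (fun j => ?_) fun k _ => ?_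
  · simp [invStokesCoef, eigenval_zero]
  · simp only [invStokesCoef, mul_left_comm _ (((eigenval L k)⁻¹ : ℝ) : ℂ), ← Finset.mul_sum,
      hf.sum_freq_mul_fourierCoef hL, mul_zero]

/-- A derivative multiplies all components of a mode by the same scalar, so it keeps the
divergence-free condition; this makes Agmon's inequality applicable to it. -/
lemma memDomA_deriv_invStokes (hL : 0 < L) (hf : MemH L f) (hS : ∀ k ∈ S, -k ∈ S) (e : E3) :
    MemDomA L 1 (trigField L S fun k j => derivSymbol L e k * invStokesCoef L f k j) := by
  have hc := isRealCoef_derivSymbol_mul (isRealCoef_invStokesCoef hS L f) L e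
  refine ⟨hc.memH_trigField hL (fun j => ?_) fun k _ => ?_, (hc.hasSum_normA hL 1).summable⟩
  · simp [invStokesCoef, eigenval_zero]
  · simp only [invStokesCoef, ← mul_assoc (derivSymbol L e k),
      mul_left_comm _ (derivSymbol L e k * (((eigenval L k)⁻¹ : ℝ) : ℂ)), ← Finset.mul_sum,
      hf.sum_freq_mul_fourierCoef hL, mul_zero]

/-- A directional derivative costs at most one factor `A^{1/2}`, so `A^{1/2} ∂_e A⁻¹` is bounded by
`‖e‖` on each mode. Both norms in Agmon's inequality follow from this. -/
lemma sum_norm_derivSymbol_mul_invStokesCoef_sq_le (e : E3) (k : Fin 3 → ℤ) :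
    eigenval L k * ∑ j, ‖derivSymbol L e k * invStokesCoef L f k j‖ ^ 2
      ≤ ‖e‖ ^ 2 * ∑ j, ‖fourierCoef L f k j‖ ^ 2 := by
  simp only [norm_mul, mul_pow, ← Finset.mul_sum, sum_norm_invStokesCoef_sq]
  have h := norm_derivSymbol_sq_le L e k
  have h0 := eigenval_nonneg L k
  set q := ∑ j, ‖fourierCoef L f k j‖ ^ 2
  have hq : 0 ≤ q := Finset.sum_nonneg fun j _ => sq_nonneg _
  rcases h0.eq_or_lt with h0 | hpos
  · rw [← h0]; simp; positivity
  · calc _ ≤ eigenval L k * (eigenval L k * ‖e‖ ^ 2 * ((eigenval L k)⁻¹ ^ 2 * q)) := by gcongr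
      _ = ‖e‖ ^ 2 * q := by field_simp

lemma normA_half_deriv_invStokes_le (hL : 0 < L) (hf : MemLp f 2 (volume.restrict (box L)))
    (hS : ∀ k ∈ S, -k ∈ S) (e : E3) :
    normA L (1 / 2) (trigField L S fun k j => derivSymbol L e k * invStokesCoef L f k j)
      ≤ ‖e‖ * normL2 L f := by
  have hc := isRealCoef_derivSymbol_mul (isRealCoef_invStokesCoef hS L f) L e
  rw [← sq_le_sq₀ (normA_nonneg _ _ _) (mul_nonneg (norm_nonneg _) (normL2_nonneg _ _)),
    hc.normA_trigField_sq hL, mul_pow]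
  refine le_trans ?_ (mul_le_mul_of_nonneg_left (sum_fourierCoef_sq_le hL hf S) (sq_nonneg _))
  rw [mul_left_comm, Finset.mul_sum S _ (‖e‖ ^ 2)]
  refine mul_le_mul_of_nonneg_left (Finset.sum_le_sum fun k _ => ?_) (by positivity)
  rw [rpow_two_mul_half]
  exact sum_norm_derivSymbol_mul_invStokesCoef_sq_le e k

lemma normA_one_deriv_invStokes_le (hL : 0 < L) (hf : MemDomA L (1 / 2) f)
    (hS : ∀ k ∈ S, -k ∈ S) (e : E3) :
    normA L 1 (trigField L S fun k j => derivSymbol L e k * invStokesCoef L f k j)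
      ≤ ‖e‖ * normA L (1 / 2) f := by
  have hc := isRealCoef_derivSymbol_mul (isRealCoef_invStokesCoef hS L f) L e
  rw [← sq_le_sq₀ (normA_nonneg _ _ _) (mul_nonneg (norm_nonneg _) (normA_nonneg _ _ _)),
    hc.normA_trigField_sq hL, mul_pow]
  refine le_trans ?_
    (mul_le_mul_of_nonneg_left (sum_eigenval_mul_le_normA_sq hL hf.2 S) (sq_nonneg _))
  rw [mul_left_comm, Finset.mul_sum S _ (‖e‖ ^ 2)]
  refine mul_le_mul_of_nonneg_left (Finset.sum_le_sum fun k _ => ?_) (by positivity)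
  rw [rpow_two_mul_half, rpow_two_mul_one, sq, mul_assoc, mul_left_comm (‖e‖ ^ 2)]
  exact mul_le_mul_of_nonneg_left (sum_norm_derivSymbol_mul_invStokesCoef_sq_le e k)
    (eigenval_nonneg L k)

/-- Agmon's inequality bounds the gradient of truncations of `A⁻¹ f`. -/
lemma ae_norm_fderiv_invStokes_le (hL : 0 < L) (hf : MemDomA L (1 / 2) f)
    (hS : ∀ k ∈ S, -k ∈ S) {C : ℝ} (hC : IsAgmonConstant L C) :
    ∀ᵐ x ∂(volume.restrict (box L)), ∀ e : E3,
      ‖fderiv ℝ (trigField L S (invStokesCoef L f)) x e‖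
        ≤ C * normL2 L f ^ (1 / 2 : ℝ) * normA L (1 / 2) f ^ (1 / 2 : ℝ) * ‖e‖ := by
  have hone : ∀ e : E3, ∀ᵐ x ∂(volume.restrict (box L)),
      ‖fderiv ℝ (trigField L S (invStokesCoef L f)) x e‖
        ≤ C * normL2 L f ^ (1 / 2 : ℝ) * normA L (1 / 2) f ^ (1 / 2 : ℝ) * ‖e‖ := fun e => by
    filter_upwards [hC.2 _ (memDomA_deriv_invStokes hL hf.1 hS e)] with x hx
    rw [fderiv_trigField]
    refine hx.trans ?_
    have hC0 := hC.1.le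
    have h1 := Real.rpow_le_rpow (normA_nonneg _ _ _)
      (normA_half_deriv_invStokes_le hL hf.1.memLp hS e) (z := 1 / 2) (by norm_num)
    have h2 := Real.rpow_le_rpow (normA_nonneg _ _ _)
      (normA_one_deriv_invStokes_le hL hf hS e) (z := 1 / 2) (by norm_num)
    rw [Real.mul_rpow (norm_nonneg _) (normL2_nonneg _ _)] at h1
    rw [Real.mul_rpow (norm_nonneg _) (normA_nonneg _ _ _)] at h2
    have he : ‖e‖ ^ (1 / 2 : ℝ) * ‖e‖ ^ (1 / 2 : ℝ) = ‖e‖ := by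
      rw [← Real.sqrt_eq_rpow, Real.mul_self_sqrt (norm_nonneg _)]
    rw [mul_assoc]
    refine (mul_le_mul_of_nonneg_left (mul_le_mul h1 h2 (Real.rpow_nonneg (normA_nonneg _ _ _) _)
      (mul_nonneg (Real.rpow_nonneg (norm_nonneg _) _)
        (Real.rpow_nonneg (normL2_nonneg _ _) _))) hC0).trans_eq ?_
    rw [mul_mul_mul_comm, he]
    ring
  -- The exceptional null set depends on the direction `e`. A countable dense family of directions
  -- gives one null set, and continuity in `e` covers the rest. Working by directions keeps Agmon's
  -- constant free of a dimensional factor.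
  have hall := ae_all_iff.mpr fun n : ℕ => hone (TopologicalSpace.denseSeq E3 n)
  filter_upwards [hall] with x hx e
  refine (TopologicalSpace.denseRange_denseSeq E3).induction_on
    (p := fun e => ‖fderiv ℝ (trigField L S (invStokesCoef L f)) x e‖
        ≤ C * normL2 L f ^ (1 / 2 : ℝ) * normA L (1 / 2) f ^ (1 / 2 : ℝ) * ‖e‖) e ?_ hx
  exact isClosed_le (by fun_prop) (by fun_prop)

end

end InverseStokes

/-! ### Testing the weak formulation with `A⁻¹ f` and the cut-off -/

section Energy

section

variable {ν L : ℝ} {f : E3 → E3} {u : ℝ → E3 → E3}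

lemma IsLerayHopf.aestronglyMeasurable_uncurry (hu : IsLerayHopf ν L f u) :
    AEStronglyMeasurable (Function.uncurry u)
      ((volume.restrict (Ioi (0 : ℝ))).prod (volume.restrict (box L))) := by
  refine hu.measurable.mono_measure ?_
  exact Measure.prod_mono (Measure.restrict_mono Ioi_subset_Ici_self le_rfl) le_rfl

lemma IsLerayHopf.aestronglyMeasurable_innerL2 (hu : IsLerayHopf ν L f u) {v : E3 → E3}
    (hv : Continuous v) :
    AEStronglyMeasurable (fun t => innerL2 L (u t) v) (volume.restrict (Ioi (0 : ℝ))) := by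
  have h : AEStronglyMeasurable (fun z : ℝ × E3 => inner ℝ (u z.1 z.2) (v z.2))
      ((volume.restrict (Ioi (0 : ℝ))).prod (volume.restrict (box L))) :=
    hu.aestronglyMeasurable_uncurry.inner (hv.comp continuous_snd).aestronglyMeasurable
  exact h.integral_prod_right'

lemma IsLerayHopf.aestronglyMeasurable_normL2 (hu : IsLerayHopf ν L f u) :
    AEStronglyMeasurable (fun t => normL2 L (u t)) (volume.restrict (Ioi (0 : ℝ))) :=
  Real.continuous_sqrt.comp_aestronglyMeasurable
    ((hu.aestronglyMeasurable_uncurry.norm.pow 2).integral_prod_right')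

lemma IsLerayHopf.aestronglyMeasurable_transport (hu : IsLerayHopf ν L f u) {v : E3 → E3}
    (hv : ContDiff ℝ ∞ v) :
    AEStronglyMeasurable
      (fun t => ∫ x in box L, inner ℝ (fderiv ℝ v x (u t x)) (u t x))
      (volume.restrict (Ioi (0 : ℝ))) := by
  have h1 : Continuous fun p : (E3 →L[ℝ] E3) × E3 => inner ℝ (p.1 p.2) p.2 := by fun_prop
  have h2 : AEStronglyMeasurable (fun z : ℝ × E3 => fderiv ℝ v z.2)
      ((volume.restrict (Ioi (0 : ℝ))).prod (volume.restrict (box L))) :=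
    ((hv.continuous_fderiv (by simp)).comp continuous_snd).aestronglyMeasurable
  exact (h1.comp_aestronglyMeasurable
    (h2.prodMk hu.aestronglyMeasurable_uncurry)).integral_prod_right'

/-- The transport term is controlled by the gradient of the test field. -/
lemma abs_transport_le {v w : E3 → E3} (hw : MemLp w 2 (volume.restrict (box L))) {K : ℝ}
    (hK : ∀ᵐ x ∂(volume.restrict (box L)), ∀ e : E3, ‖fderiv ℝ v x e‖ ≤ K * ‖e‖) :
    |∫ x in box L, inner ℝ (fderiv ℝ v x (w x)) (w x)| ≤ K * normL2 L w ^ 2 := by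
  rw [normL2, Real.sq_sqrt (integral_nonneg fun x => by positivity), ← integral_const_mul,
    ← Real.norm_eq_abs]
  refine norm_integral_le_of_norm_le ((hw.integrable_norm_pow two_ne_zero).const_mul K) ?_
  filter_upwards [hK] with x hx
  calc ‖inner ℝ (fderiv ℝ v x (w x)) (w x)‖ ≤ ‖fderiv ℝ v x (w x)‖ * ‖w x‖ :=
        norm_inner_le_norm _ _
    _ ≤ K * ‖w x‖ * ‖w x‖ := by gcongr; exact hx _
    _ = K * ‖w x‖ ^ 2 := by ring

lemma integrable_mul_of_bounded {φ g : ℝ → ℝ} (hφ : Continuous φ) (hc : HasCompactSupport φ)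
    (hg : AEStronglyMeasurable g (volume.restrict (Ioi (0 : ℝ)))) {M : ℝ}
    (hM : ∀ᵐ t ∂(volume.restrict (Ioi (0 : ℝ))), |g t| ≤ M) :
    Integrable (fun t => φ t * g t) (volume.restrict (Ioi (0 : ℝ))) :=
  ((hφ.integrable_of_hasCompactSupport hc).restrict).mul_bdd hg hM

end

/-- The weak formulation tested with a truncation of `A⁻¹ f` and a time cut-off. -/
lemma IsLerayHopf.mul_integral_cutoff_le {ν L T C₀ δ C : ℝ} {η : ℝ → ℝ} {f : E3 → E3}
    {u : ℝ → E3 → E3} (hν : 0 < ν) (hL : 0 < L) (hδ : 0 < δ) (hδ1 : δ ≤ 1)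
    (hC : IsAgmonConstant L C) (hη : IsTimeCutoff T C₀ δ η) (hf : MemDomA L (1 / 2) f)
    (hu : IsLerayHopf ν L f u) {S : Finset (Fin 3 → ℤ)} (hS : ∀ k ∈ S, -k ∈ S) :
    innerL2 L f (trigField L S (invStokesCoef L f)) * ∫ t in Ioi (0 : ℝ), η t
      ≤ ∫ t in Ioi (0 : ℝ), η t ^ δ *
          ((C₀ / T * normA L (-1) f + ν * normL2 L f) * normL2 L (u t)
            + C * normL2 L f ^ (1 / 2 : ℝ) * normA L (1 / 2) f ^ (1 / 2 : ℝ)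
              * normL2 L (u t) ^ 2) := by
  set v := trigField L S (invStokesCoef L f) with hv
  set fS := trigField L S (fourierCoef L f) with hfS
  set K := C * normL2 L f ^ (1 / 2 : ℝ) * normA L (1 / 2) f ^ (1 / 2 : ℝ) with hKdef
  set p := innerL2 L f v with hp
  have hK0 : 0 ≤ K := mul_nonneg (mul_nonneg hC.1.le (Real.rpow_nonneg (normL2_nonneg _ _) _))
    (Real.rpow_nonneg (normA_nonneg _ _ _) _)
  have hvs : ContDiff ℝ ∞ v := contDiff_trigField _ _ _
  have hfSs : ContDiff ℝ ∞ fS := contDiff_trigField _ _ _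
  obtain ⟨M, hM⟩ := hu.bounded
  have hM' : ∀ᵐ t ∂(volume.restrict (Ioi (0 : ℝ))), normL2 L (u t) ≤ M :=
    ae_restrict_of_ae_restrict_of_subset Ioi_subset_Ici_self hM
  have hpos : ∀ᵐ t ∂(volume.restrict (Ioi (0 : ℝ))), (0 : ℝ) < t :=
    ae_restrict_mem measurableSet_Ioi
  set N : ℝ → ℝ := fun t => normL2 L (u t) with hN
  have hN0 : ∀ t, 0 ≤ N t := fun t => normL2_nonneg _ _
  set g : ℝ → ℝ := fun t => innerL2 L (u t) v with hg
  set a : ℝ → ℝ := fun t => innerL2 L (u t) fS with ha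
  set b : ℝ → ℝ := fun t => ∫ x in box L, inner ℝ (fderiv ℝ v x (u t x)) (u t x) with hb
  have hgm : AEStronglyMeasurable g (volume.restrict (Ioi (0 : ℝ))) :=
    hu.aestronglyMeasurable_innerL2 hvs.continuous
  have ham : AEStronglyMeasurable a (volume.restrict (Ioi (0 : ℝ))) :=
    hu.aestronglyMeasurable_innerL2 hfSs.continuous
  have hbm : AEStronglyMeasurable b (volume.restrict (Ioi (0 : ℝ))) :=
    hu.aestronglyMeasurable_transport hvs
  have hNm : AEStronglyMeasurable N (volume.restrict (Ioi (0 : ℝ))) :=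
    hu.aestronglyMeasurable_normL2
  have hgb : ∀ t, 0 < t → |g t| ≤ normA L (-1) f * N t := fun t ht => by
    rw [mul_comm]
    exact (abs_innerL2_le (hu.memH t ht.le).memLp (memLp_trigField _ _ _)).trans
      (mul_le_mul_of_nonneg_left (normL2_invStokes_le hL hf.1.memLp hS) (hN0 t))
  have hab : ∀ t, 0 < t → |a t| ≤ normL2 L f * N t := fun t ht => by
    rw [mul_comm]
    exact (abs_innerL2_le (hu.memH t ht.le).memLp (memLp_trigField _ _ _)).trans
      (mul_le_mul_of_nonneg_left (normL2_trunc_le hL hf.1.memLp hS) (hN0 t))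
  have hbb : ∀ t, 0 < t → |b t| ≤ K * N t ^ 2 := fun t ht =>
    abs_transport_le (hu.memH t ht.le).memLp (ae_norm_fderiv_invStokes_le hL hf hS hC)
  have hgM : ∀ᵐ t ∂(volume.restrict (Ioi (0 : ℝ))), |g t| ≤ normA L (-1) f * M := by
    filter_upwards [hM', hpos] with t h1 h2
    exact (hgb t h2).trans (mul_le_mul_of_nonneg_left h1 (normA_nonneg _ _ _))
  have haM : ∀ᵐ t ∂(volume.restrict (Ioi (0 : ℝ))), |a t| ≤ normL2 L f * M := by
    filter_upwards [hM', hpos] with t h1 h2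
    exact (hab t h2).trans (mul_le_mul_of_nonneg_left h1 (normL2_nonneg _ _))
  have hbM : ∀ᵐ t ∂(volume.restrict (Ioi (0 : ℝ))), |b t| ≤ K * M ^ 2 := by
    filter_upwards [hM', hpos] with t h1 h2
    exact (hbb t h2).trans
      (mul_le_mul_of_nonneg_left (pow_le_pow_left₀ (hN0 t) h1 2) hK0)
  -- By the weak formulation, `h` is minus the weak time derivative of `g`.
  set h : ℝ → ℝ := fun t => ν * a t - b t - p with hh
  have hhm : AEStronglyMeasurable h (volume.restrict (Ioi (0 : ℝ))) :=
    ((ham.const_mul ν).sub hbm).sub aestronglyMeasurable_const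
  have hhM : ∀ᵐ t ∂(volume.restrict (Ioi (0 : ℝ))),
      |h t| ≤ ν * (normL2 L f * M) + K * M ^ 2 + |p| := by
    filter_upwards [haM, hbM] with t h1 h2
    have e1 : |ν * a t| ≤ ν * (normL2 L f * M) := by
      rw [abs_mul, abs_of_pos hν]; exact mul_le_mul_of_nonneg_left h1 hν.le
    have e2 := abs_sub (ν * a t - b t) p
    have e3 := abs_sub (ν * a t) (b t)
    linarith
  have hweak : ∀ φ : ℝ → ℝ, ContDiff ℝ ∞ φ → HasCompactSupport φ → tsupport φ ⊆ Ioi 0 →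
      ∫ t in Ioi (0 : ℝ), deriv φ t * g t = ∫ t in Ioi (0 : ℝ), φ t * h t := by
    intro φ hφ hφc hφs
    have hw := hu.weakForm v hvs (memH_invStokes hL hf.1 hS) φ hφ hφc hφs
    have hA : ∫ t in Ioi (0 : ℝ), φ t * innerA L (1 / 2) (u t) v
        = ∫ t in Ioi (0 : ℝ), φ t * a t := by
      refine setIntegral_congr_fun measurableSet_Ioi fun t ht => ?_
      simp only [hv, ha, hfS]
      rw [innerA_half_invStokes hL hf.1 hS (hu.memH t (le_of_lt ht)).memLp]
    rw [hA] at hw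
    have ia := integrable_mul_of_bounded hφ.continuous hφc ham haM
    have ib := integrable_mul_of_bounded hφ.continuous hφc hbm hbM
    have ip : Integrable (fun t => φ t * p) (volume.restrict (Ioi (0 : ℝ))) :=
      ((hφ.continuous.integrable_of_hasCompactSupport hφc).restrict).mul_const p
    have e : ∫ t in Ioi (0 : ℝ), φ t * h t
        = ν * (∫ t in Ioi (0 : ℝ), φ t * a t) - (∫ t in Ioi (0 : ℝ), φ t * b t)
          - ∫ t in Ioi (0 : ℝ), φ t * p := by
      have iab : Integrable (fun t => ν * (φ t * a t) - φ t * b t)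
          (volume.restrict (Ioi (0 : ℝ))) := (ia.const_mul ν).sub ib
      rw [← integral_const_mul, ← integral_sub (ia.const_mul ν) ib, ← integral_sub iab ip]
      refine integral_congr_ae (Filter.Eventually.of_forall fun t => ?_)
      simp only [hh]; ring
    rw [e]
    linarith
  have hid := integral_deriv_mul_eq_of_forall_test hgm hgM hhm hhM hweak hη.contDiff
    hη.support_subset
  have hcs : HasCompactSupport η := isCompact_Icc.of_isClosed_subset isClosed_closure
    (closure_minimal hη.support_subset isClosed_Icc)
  have hηc := hη.contDiff.continuous
  have hdc : Continuous (deriv η) := hη.contDiff.continuous_deriv le_rfl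
  have iη : Integrable η (volume.restrict (Ioi (0 : ℝ))) :=
    (hηc.integrable_of_hasCompactSupport hcs).restrict
  have ih := integrable_mul_of_bounded hηc hcs hhm hhM
  have ig := integrable_mul_of_bounded hdc hcs.deriv hgm hgM
  have hηδc : Continuous fun t => η t ^ δ := hηc.rpow_const fun _ => Or.inr hδ.le
  have hηδs : HasCompactSupport fun t => η t ^ δ :=
    hcs.comp_left (g := fun x : ℝ => x ^ δ) (Real.zero_rpow hδ.ne')
  -- The added integral of `η h - η' g` is zero; it turns the constant `p` into an integrand in
  -- which the terms `p * η t` cancel pointwise.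
  have e1 : p * ∫ t in Ioi (0 : ℝ), η t
      = ∫ t in Ioi (0 : ℝ), (p * η t + (η t * h t - deriv η t * g t)) := by
    have ihg : Integrable (fun t => η t * h t - deriv η t * g t)
        (volume.restrict (Ioi (0 : ℝ))) := ih.sub ig
    rw [integral_add (iη.const_mul p) ihg, integral_sub ih ig, hid, sub_self, add_zero,
      integral_const_mul]
  rw [e1]
  set α := normA L (-1) f with hα
  set F := normL2 L f with hF
  have hα0 : 0 ≤ α := normA_nonneg _ _ _
  have hF0 : 0 ≤ F := normL2_nonneg _ _
  refine integral_mono_ae ((iη.const_mul p).add (ih.sub ig)) ?_ ?_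
  · refine integrable_mul_of_bounded hηδc hηδs
      (M := |C₀ / T * α + ν * F| * M + K * M ^ 2)
      ((hNm.const_mul _).add ((hNm.pow 2).const_mul K)) ?_
    filter_upwards [hM'] with t h1
    refine (abs_add_le _ _).trans (add_le_add ?_ ?_)
    · rw [abs_mul, abs_of_nonneg (hN0 t)]
      exact mul_le_mul_of_nonneg_left h1 (abs_nonneg _)
    · rw [abs_of_nonneg (mul_nonneg hK0 (sq_nonneg _))]
      exact mul_le_mul_of_nonneg_left (pow_le_pow_left₀ (hN0 t) h1 2) hK0
  · filter_upwards [hpos] with t ht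
    have hη0 := hη.nonneg t
    have hηδ : η t ≤ η t ^ δ := by
      simpa using Real.rpow_le_rpow_of_exponent_ge' hη0 (hη.le_one t) hδ.le hδ1
    have hηδ0 : 0 ≤ η t ^ δ := Real.rpow_nonneg hη0 _
    have b1 : η t * (ν * a t - b t) ≤ η t ^ δ * (ν * F * N t + K * N t ^ 2) := by
      have q1 := (abs_le.mp (hab t ht)).2
      have q2 := (abs_le.mp (hbb t ht)).1
      have q3 : ν * a t - b t ≤ ν * F * N t + K * N t ^ 2 := by
        have := mul_le_mul_of_nonneg_left q1 hν.le
        linarith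
      have q4 : 0 ≤ ν * F * N t + K * N t ^ 2 := by have := hN0 t; positivity
      exact (mul_le_mul_of_nonneg_left q3 hη0).trans (mul_le_mul_of_nonneg_right hηδ q4)
    have b2 : -(deriv η t * g t) ≤ η t ^ δ * (C₀ / T * α * N t) := by
      refine (neg_le_abs _).trans ?_
      rw [abs_mul]
      refine (mul_le_mul (hη.deriv_bound t) (hgb t ht) (abs_nonneg _)
        ((abs_nonneg _).trans (hη.deriv_bound t))).trans_eq ?_
      ring
    simp only [hh]
    change p * η t + (η t * (ν * a t - b t - p) - deriv η t * g t)
      ≤ η t ^ δ * ((C₀ / T * α + ν * F) * N t + K * N t ^ 2)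
    nlinarith [b1, b2]

/-- Lower bound extracted from a quadratic inequality with a free parameter. -/
lemma lower_bound_of_quadratic {D G K E X : ℝ} (hK : 0 < K) (hG : 0 ≤ G) (hD : 0 < D)
    (hX : X = D / (2 * K)) (hsmall : G ^ 2 * X ≤ D ^ 2 / 4)
    (hquad : ∀ θ : ℝ, 0 < θ → D ≤ G * (θ / 2 + E / (2 * θ)) + K * E) : X ≤ E := by
  by_contra hlt
  push Not at hlt
  have hX0 : 0 < X := by rw [hX]; positivity
  have hs := Real.sqrt_pos.mpr hX0
  have hs2 := Real.sq_sqrt hX0.le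
  -- With `θ = √X` and `E < X`, the bracket is at most `√X`.
  have h1 := hquad (√X) hs
  have h2 : √X / 2 + E / (2 * √X) ≤ √X := by
    have : E / (2 * √X) ≤ √X / 2 := by
      rw [div_le_div_iff₀ (by positivity) (by norm_num)]
      nlinarith
    linarith
  have h3 : G * √X ≤ D / 2 := by
    refine abs_le_of_sq_le_sq' ?_ (by positivity) |>.2
    rw [mul_pow, hs2]
    linarith
  have h4 : K * X = D / 2 := by rw [hX]; field_simp
  have h5 : K * E < K * X := mul_lt_mul_of_pos_left hlt hK
  have h6 := mul_le_mul_of_nonneg_left h2 hG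
  linarith

end Energy

/-! ### The time-averaged balance and the limit over frequencies -/

section Balance

lemma integral_Ioi_eq_intervalIntegral {T : ℝ} (hT : 0 ≤ T) {g : ℝ → ℝ}
    (hg : ∀ t, t ∉ Icc 0 T → g t = 0) : ∫ t in Ioi (0 : ℝ), g t = ∫ t in (0 : ℝ)..T, g t := by
  rw [intervalIntegral.integral_of_le hT]
  refine setIntegral_eq_of_subset_of_forall_sdiff_eq_zero measurableSet_Ioi
    Ioc_subset_Ioi_self fun t ht => hg t fun h => ht.2 ⟨ht.1, h.2⟩

lemma energy_nonneg {L T δ : ℝ} {η : ℝ → ℝ} (hL : 0 < L) (hT : 0 < T) (hη : ∀ t, 0 ≤ η t)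
    (u : ℝ → E3 → E3) : 0 ≤ energy L T δ η u := by
  refine mul_nonneg (by positivity) (intervalIntegral.integral_nonneg hT.le fun t _ => ?_)
  exact mul_nonneg (Real.rpow_nonneg (hη t) _) (by positivity)

/-- The time-averaged balance, as a quadratic inequality with a free parameter `θ`. -/
lemma IsLerayHopf.cutoffMean_mul_normA_sq_le {ν L T C₀ δ C : ℝ} {η : ℝ → ℝ} {f : E3 → E3}
    {u : ℝ → E3 → E3} (hν : 0 < ν) (hL : 0 < L) (hT : 0 < T) (hC₀ : 0 < C₀) (hδ : 0 < δ)
    (hδ1 : δ ≤ 1) (hC : IsAgmonConstant L C) (hη : IsTimeCutoff T C₀ δ η)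
    (hc : 0 < cutoffMean T η) (hf : MemDomA L (1 / 2) f) (hu : IsLerayHopf ν L f u)
    {θ : ℝ} (hθ : 0 < θ) :
    cutoffMean T η * normA L (-1 / 2) f ^ 2
      ≤ (C₀ / T * normA L (-1) f + ν * normL2 L f) *
          (θ / 2 + (1 / T * ∫ t in (0 : ℝ)..T, η t ^ δ * normL2 L (u t) ^ 2) / (2 * θ))
        + C * normL2 L f ^ (1 / 2 : ℝ) * normA L (1 / 2) f ^ (1 / 2 : ℝ)
          * (1 / T * ∫ t in (0 : ℝ)..T, η t ^ δ * normL2 L (u t) ^ 2) := by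
  set c := cutoffMean T η with hcdef
  set K := C * normL2 L f ^ (1 / 2 : ℝ) * normA L (1 / 2) f ^ (1 / 2 : ℝ) with hKdef
  set G := C₀ / T * normA L (-1) f + ν * normL2 L f with hG
  set I := ∫ t in (0 : ℝ)..T, η t ^ δ * normL2 L (u t) ^ 2 with hI
  have hG0 : 0 ≤ G := by
    have := normA_nonneg L (-1) f
    have := normL2_nonneg L f
    positivity
  have hout : ∀ t, t ∉ Icc 0 T → η t = 0 := fun t ht => by
    by_contra h; exact ht (hη.support_subset h)
  have hcs : HasCompactSupport η := isCompact_Icc.of_isClosed_subset isClosed_closure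
    (closure_minimal hη.support_subset isClosed_Icc)
  have hηc := hη.contDiff.continuous
  have hηδc : Continuous fun t => η t ^ δ := hηc.rpow_const fun _ => Or.inr hδ.le
  have hηδs : HasCompactSupport fun t => η t ^ δ :=
    hcs.comp_left (g := fun x : ℝ => x ^ δ) (Real.zero_rpow hδ.ne')
  have hηδ0 : ∀ t, 0 ≤ η t ^ δ := fun t => Real.rpow_nonneg (hη.nonneg t) _
  obtain ⟨M, hM⟩ := hu.bounded
  have hM' : ∀ᵐ t ∂(volume.restrict (Ioi (0 : ℝ))), normL2 L (u t) ≤ M :=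
    ae_restrict_of_ae_restrict_of_subset Ioi_subset_Ici_self hM
  have iδ : Integrable (fun t => η t ^ δ) (volume.restrict (Ioi (0 : ℝ))) :=
    (hηδc.integrable_of_hasCompactSupport hηδs).restrict
  have iN : Integrable (fun t => η t ^ δ * normL2 L (u t)) (volume.restrict (Ioi (0 : ℝ))) :=
    integrable_mul_of_bounded hηδc hηδs hu.aestronglyMeasurable_normL2 (M := M) (by
      filter_upwards [hM'] with t ht
      rwa [abs_of_nonneg (normL2_nonneg _ _)])
  have iN2 : Integrable (fun t => η t ^ δ * normL2 L (u t) ^ 2)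
      (volume.restrict (Ioi (0 : ℝ))) :=
    integrable_mul_of_bounded hηδc hηδs (hu.aestronglyMeasurable_normL2.pow 2) (M := M ^ 2) (by
      filter_upwards [hM'] with t ht
      rw [abs_of_nonneg (sq_nonneg _)]
      exact pow_le_pow_left₀ (normL2_nonneg _ _) ht 2)
  have hIeq : ∫ t in Ioi (0 : ℝ), η t ^ δ * normL2 L (u t) ^ 2 = I :=
    integral_Ioi_eq_intervalIntegral hT.le fun t ht => by
      rw [hout t ht, Real.zero_rpow hδ.ne', zero_mul]
  have hηeq : ∫ t in Ioi (0 : ℝ), η t = T * c := by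
    rw [integral_Ioi_eq_intervalIntegral hT.le hout, hcdef, cutoffMean]
    field_simp
  have hδle : ∫ t in Ioi (0 : ℝ), η t ^ δ ≤ T := by
    rw [integral_Ioi_eq_intervalIntegral hT.le fun t ht => by
      rw [hout t ht, Real.zero_rpow hδ.ne']]
    calc ∫ t in (0 : ℝ)..T, η t ^ δ ≤ ∫ _t in (0 : ℝ)..T, (1 : ℝ) :=
          intervalIntegral.integral_mono_on hT.le (hηδc.intervalIntegrable _ _)
            (by simp) fun t _ => Real.rpow_le_one (hη.nonneg t) (hη.le_one t) hδ.le
      _ = T := by simp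
  have hrhs : ∫ t in Ioi (0 : ℝ), η t ^ δ * (G * normL2 L (u t) + K * normL2 L (u t) ^ 2)
      ≤ G * (θ / 2) * T + (G / (2 * θ) + K) * I := by
    calc _ ≤ ∫ t in Ioi (0 : ℝ), (G * (θ / 2) * η t ^ δ
            + (G / (2 * θ) + K) * (η t ^ δ * normL2 L (u t) ^ 2)) := by
          refine integral_mono ?_ ((iδ.const_mul _).add (iN2.const_mul _)) fun t => ?_
          · refine ((iN.const_mul G).add (iN2.const_mul K)).congr
              (Filter.Eventually.of_forall fun t => ?_)
            simp only [Pi.add_apply]; ring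
          -- Young's inequality; since `η^δ ≤ 1`, the `θ` part later integrates to at most `G * (θ /
          -- 2) * T`.
          · have hamgm : normL2 L (u t) ≤ θ / 2 + normL2 L (u t) ^ 2 / (2 * θ) := by
              have : θ / 2 + normL2 L (u t) ^ 2 / (2 * θ) - normL2 L (u t)
                  = (normL2 L (u t) - θ) ^ 2 / (2 * θ) := by field_simp; ring
              have h2 : 0 ≤ (normL2 L (u t) - θ) ^ 2 / (2 * θ) := by positivity
              linarith
            have h3 := mul_le_mul_of_nonneg_left hamgm (mul_nonneg (hηδ0 t) hG0)
            have h4 : η t ^ δ * G * (θ / 2 + normL2 L (u t) ^ 2 / (2 * θ))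
                = G * (θ / 2) * η t ^ δ + G / (2 * θ) * (η t ^ δ * normL2 L (u t) ^ 2) := by
              ring
            simp only
            linarith
      _ = G * (θ / 2) * (∫ t in Ioi (0 : ℝ), η t ^ δ) + (G / (2 * θ) + K) * I := by
          rw [integral_add (iδ.const_mul _) (iN2.const_mul _), integral_const_mul,
            integral_const_mul, hIeq]
      _ ≤ _ := by gcongr
  -- The right-hand side does not depend on `S`, so the bound passes to the full series.
  have hfin : ∀ S : Finset (Fin 3 → ℤ),
      ∑ k ∈ S, eigenval L k ^ (2 * (-1 / 2) : ℝ) * ∑ j, ‖fourierCoef L f k j‖ ^ 2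
        ≤ (G * (θ / 2) * T + (G / (2 * θ) + K) * I) / (T * c) / L ^ 3 := by
    intro S
    classical
    -- Symmetrised, because a real truncation needs `-k` along with `k`; enlarging the set only
    -- increases the sum.
    set S' := S ∪ S.image fun k => -k with hS'
    have hsym : ∀ k ∈ S', -k ∈ S' := by
      intro k hk
      simp only [hS', Finset.mem_union, Finset.mem_image] at hk ⊢
      rcases hk with hk | ⟨m, hm, rfl⟩
      · exact Or.inr ⟨k, hk, rfl⟩
      · exact Or.inl (by simpa using hm)
    have h1 := hu.mul_integral_cutoff_le hν hL hδ hδ1 hC hη hf hsym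
    rw [hηeq, innerL2_invStokes hL hf.1.memLp hsym] at h1
    have h2 := h1.trans hrhs
    rw [le_div_iff₀ (by positivity), le_div_iff₀ (by positivity)]
    refine le_trans (mul_le_mul_of_nonneg_right ?_ (by positivity)) h2
    rw [mul_comm]
    refine mul_le_mul_of_nonneg_left (Finset.sum_le_sum_of_subset_of_nonneg
      Finset.subset_union_left fun k _ _ => ?_) (by positivity)
    have := eigenval_nonneg L k
    positivity
  have htsum := Real.tsum_le_of_sum_le (fun k => by
    have := eigenval_nonneg L k
    simp only [Pi.zero_apply]
    positivity) hfin
  rw [normA_sq hL]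
  calc c * (L ^ 3 * ∑' k : Fin 3 → ℤ,
        eigenval L k ^ (2 * (-1 / 2) : ℝ) * ∑ j, ‖fourierCoef L f k j‖ ^ 2)
      ≤ c * (L ^ 3 * ((G * (θ / 2) * T + (G / (2 * θ) + K) * I) / (T * c) / L ^ 3)) := by gcongr
    _ = _ := by field_simp; ring

end Balance

end PeriodicNSE

end

/-! ### The lower bound on the energy -/

theorem theorem3 :
    -- the Agmon inequality holds, with a constant independent of the period
    (∃ C : ℝ, ∀ L : ℝ, 0 < L → PeriodicNSE.IsAgmonConstant L C) ∧
    -- the lower bound, for every admissible Agmon constant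
    ∀ (ν L R₀ T C₀ δ C_A : ℝ) (η : ℝ → ℝ) (f : PeriodicNSE.E3 → PeriodicNSE.E3)
      (u : ℝ → PeriodicNSE.E3 → PeriodicNSE.E3),
      0 < ν → 0 < L → R₀ = L / 4 → 0 < T → 0 < C₀ → 1 / 2 < δ → δ < 1 →
      PeriodicNSE.IsAgmonConstant L C_A →
      PeriodicNSE.IsTimeCutoff T C₀ δ η →
      0 < PeriodicNSE.cutoffMean T η →
      PeriodicNSE.MemDomA L (1 / 2) f →
      0 < PeriodicNSE.normL2 L f →
      PeriodicNSE.IsLerayHopf ν L f u →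
      2 * PeriodicNSE.gammaF ν L T C₀ f ^ 2 * ν ^ 2 / (PeriodicNSE.cutoffMean T η * C_A)
          * (PeriodicNSE.normL2 L f ^ (1 / 2 : ℝ) / PeriodicNSE.normA L (1 / 2) f ^ (1 / 2 : ℝ))
          * (PeriodicNSE.normL2 L f ^ 2 / PeriodicNSE.normA L (-1 / 2) f ^ 2)
        ≤ PeriodicNSE.normL2 L f →
      PeriodicNSE.cutoffMean T η / (4 * C_A) * (1 / R₀ ^ (5 / 2 : ℝ))
          * (PeriodicNSE.normA L (-1 / 2) f ^ 2
              / (PeriodicNSE.normL2 L f ^ (3 / 2 : ℝ)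
                  * PeriodicNSE.normA L (1 / 2) f ^ (1 / 2 : ℝ)))
          * (PeriodicNSE.normL2 L f / R₀ ^ (1 / 2 : ℝ))
        ≤ PeriodicNSE.energy L T δ η u := by
  refine ⟨⟨18, fun L hL => PeriodicNSE.isAgmonConstant hL⟩, ?_⟩
  intro ν L R₀ T C₀ δ C_A η f u hν hL hR hT hC₀ hδ hδ1 hC hη hc hf hF hu hyp
  have hδ0 : 0 < δ := by linarith
  have hE0 := PeriodicNSE.energy_nonneg (δ := δ) hL hT hη.nonneg u
  have hCpos := hC.1
  have hR0 : 0 < R₀ := by rw [hR]; positivity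
  have hquad := fun (θ : ℝ) (hθ : 0 < θ) =>
    hu.cutoffMean_mul_normA_sq_le hν hL hT hC₀ hδ0 hδ1.le hC hη hc hf hθ
  -- If `‖A^{-1/2} f‖` or `‖A^{1/2} f‖` is zero, the left-hand side is 0, by its numerator or by
  -- division by zero respectively. Both norms are positive from here on.
  rcases (PeriodicNSE.normA_nonneg L (-1 / 2) f).eq_or_lt with ha | ha
  · rw [← ha]; simpa using hE0
  rcases (PeriodicNSE.normA_nonneg L (1 / 2) f).eq_or_lt with hψ | hψ
  · rw [← hψ, Real.zero_rpow (by norm_num)]; simpa using hE0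
  set c := PeriodicNSE.cutoffMean T η
  set a := PeriodicNSE.normA L (-1 / 2) f
  set α := PeriodicNSE.normA L (-1) f
  set F := PeriodicNSE.normL2 L f
  set s := PeriodicNSE.normA L (1 / 2) f ^ (1 / 2 : ℝ)
  have hs : 0 < s := Real.rpow_pos_of_pos hψ _
  have hα0 : 0 ≤ α := PeriodicNSE.normA_nonneg _ _ _
  set r := F ^ (1 / 2 : ℝ) with hr
  have hr0 : 0 < r := Real.rpow_pos_of_pos hF _
  have hrF : r ^ 2 = F := by
    rw [hr, ← Real.sqrt_eq_rpow, Real.sq_sqrt hF.le]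
  have hF32 : F ^ (3 / 2 : ℝ) = F * r := by
    rw [hr, show (3 / 2 : ℝ) = 1 + 1 / 2 by norm_num, Real.rpow_add hF, Real.rpow_one]
  have hRpow : R₀ ^ (5 / 2 : ℝ) * R₀ ^ (1 / 2 : ℝ) = R₀ ^ 3 := by
    rw [← Real.rpow_add hR0, ← Real.rpow_natCast]; norm_num
  set G := C₀ / T * α + ν * F with hG
  have hGγ : G = ν * F * PeriodicNSE.gammaF ν L T C₀ f := by
    change C₀ / T * α + ν * F = ν * F * (C₀ / (ν * T) * (α / F) + 1)
    field_simp
  set E := 1 / T * ∫ t in (0 : ℝ)..T, η t ^ δ * PeriodicNSE.normL2 L (u t) ^ 2 with hE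
  have hG0 : 0 ≤ G := by positivity
  -- After substituting `G = ν F γ` and cancelling one factor `r = F^{1/2}`, this is the hypothesis
  -- on the force, `2γ²ν²F² ≤ c a² C_A r s`.
  have hsmall : G ^ 2 * (c * a ^ 2 / (2 * (C_A * r * s))) ≤ (c * a ^ 2) ^ 2 / 4 := by
    set γ := PeriodicNSE.gammaF ν L T C₀ f
    have e : 2 * γ ^ 2 * ν ^ 2 / (c * C_A) * (r / s) * (F ^ 2 / a ^ 2)
        = r * (2 * γ ^ 2 * ν ^ 2 * F ^ 2) / (c * C_A * s * a ^ 2) := by field_simp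
    rw [e, div_le_iff₀ (by positivity), ← hrF] at hyp
    have h2 : 2 * γ ^ 2 * ν ^ 2 * F ^ 2 ≤ r * (c * C_A * s * a ^ 2) := by
      rw [hrF] at hyp
      refine le_of_mul_le_mul_left ?_ hr0
      calc _ ≤ F * (c * C_A * s * a ^ 2) := hyp
        _ = _ := by rw [← hrF]; ring
    rw [hGγ, mul_div_assoc', div_le_div_iff₀ (by positivity) (by norm_num)]
    have h3 := mul_le_mul_of_nonneg_left h2 (show 0 ≤ 2 * (c * a ^ 2) by positivity)
    nlinarith [h3]
  have hmain := PeriodicNSE.lower_bound_of_quadratic (by positivity) hG0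
    (by positivity) rfl hsmall hquad
  have henergy : PeriodicNSE.energy L T δ η u = E / (2 * R₀ ^ 3) := by
    rw [PeriodicNSE.energy, hE, ← hR]
    have : ∀ t, η t ^ δ * (PeriodicNSE.normL2 L (u t) ^ 2 / 2)
        = (1 / 2) * (η t ^ δ * PeriodicNSE.normL2 L (u t) ^ 2) := fun t => by ring
    simp only [this, intervalIntegral.integral_const_mul]
    field_simp
  rw [henergy, hF32]
  -- The powers `5/2` and `1/2` of `R₀` combine to the volume factor `R₀ ^ 3`; the constant `4` is
  -- the `2` in `D / (2K)` times the `2` of the kinetic energy.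
  have hlhs : c / (4 * C_A) * (1 / R₀ ^ (5 / 2 : ℝ)) * (a ^ 2 / (F * r * s))
      * (F / R₀ ^ (1 / 2 : ℝ)) = c * a ^ 2 / (2 * (C_A * r * s)) / (2 * R₀ ^ 3) := by
    rw [← hRpow]
    have h5 := Real.rpow_pos_of_pos hR0 (5 / 2)
    have h1 := Real.rpow_pos_of_pos hR0 (1 / 2)
    field_simp
    ring
  rw [hlhs]
  gcongr
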